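/- Let $\nu,n,m,r\ge 0$ be integers, and let $A_\ell\in\mathbb R^{n\times n}$, $B_\ell\in\mathbb R^{n\times m}$, $C_\ell\in\mathbb R^{r\times n}$, $D_\ell\in\mathbb R^{r\times m}$, $G_\ell\in\mathbb R^{m\times r}$ ($\ell\in\mathbb Z^\nu$) be matrices with $$\sum_{\ell\in\mathbb Z^\nu}\left\|\begin{bmatrix}A_\ell&B_\ell\\ C_\ell&D_\ell\end{bmatrix}\right\|^2<\infty,\qquad \sum_{\ell\in\mathbb Z^\nu}\|G_\ell\|^2<\infty .$$ Let $\mathbb T=\mathbb R/2\pi\mathbb Z$, and let $\mathcal A(\sigma)=\sum_{\ell}e^{-i\ell^{\mathsf T}\sigma}A_\ell$ be the symbol of $(A_\ell)$, the series converging in $L^2(\mathbb T^\nu)$; define $\mathcal B,\mathcal C,\mathcal D,\mathcal G$ in the same way from $(B_\ell),(C_\ell),(D_\ell),(G_\ell)$. Assume that $$\operatorname*{ess\,sup}_{\sigma\in\mathbb T^\nu}\|\mathcal M(\sigma)\|<\infty\qquad\text{for each }\mathcal M\in\{\mathcal A,\mathcal B,\mathcal C,\mathcal D,\mathcal G\}$$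 ($\|\cdot\|$ being the operator norm), and that $\mathcal A(\sigma)$ is Hurwitz (all its eigenvalues have negative real parts) for almost every $\sigma\in\mathbb T^\nu$. Consider the network with state $x(t)\in\ell^2(\mathbb Z^\nu,\mathbb R^n)$, input $u(t)\in\ell^2(\mathbb Z^\nu,\mathbb R^m)$ and output $y(t)\in\ell^2(\mathbb Z^\nu,\mathbb R^r)$, started at $x(0)=0$ and governed for $t\ge 0$, $j\in\mathbb Z^\nu$ by $$\dot x_j=\sum_{k\in\mathbb Z^\nu}(A_{j-k}x_k+B_{j-k}u_k),\qquad y_j=\sum_{k\in\mathbb Z^\nu}(C_{j-k}x_k+D_{j-k}u_k),$$ where the differential equation is understood as the integral equation $x_j(t)=\int_0^t\sum_k(A_{j-k}x_k(\tau)+B_{j-k}u_k(\tau))\,d\tau$ with $x$ continuous in time. Then the following are equivalent. 1. The network is passive: for every input $u$ with $\int_0^T\sum_k|u_k(t)|^2\,dt<\infty$ for all $T>0$, one has $$\int_0^T\langle u(t),Gy(t)\rangle\,dt=\int_0^T\sum_{j\in\mathbb Z^\nu}u_j(t)^{\mathsf T}\sum_{k\in\mathbb Z^\nu}G_{j-k}\,y_k(t)\,dt\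 \ge\ 0\qquad\text{for all }T>0 .$$ 2. The spatio-temporal transfer function $F(s,\sigma)=\mathcal C(\sigma)(sI_n-\mathcal A(\sigma))^{-1}\mathcal B(\sigma)+\mathcal D(\sigma)$ satisfies $$F(i\omega,\sigma)^*\mathcal G(\sigma)^*+\mathcal G(\sigma)F(i\omega,\sigma)\succcurlyeq 0\qquad\text{for almost all }(\omega,\sigma)\in\mathbb R\times\mathbb T^\nu .$$ -/

import Mathlib

open MeasureTheory
open scoped Matrix.Norms.L2Operator ComplexOrder

noncomputable section

namespace LatticeNetwork

/-- The lattice `ℤ^ν`. -/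
abbrev Lattice (ν : ℕ) : Type := Fin ν → ℤ

instance factTwoPiPos : Fact (0 < 2 * Real.pi) := ⟨Real.two_pi_pos⟩

/-- The torus `𝕋^ν` with `𝕋 = ℝ / 2πℤ`; its `volume` has total mass `(2π)^ν`. -/
abbrev Torus (ν : ℕ) : Type := Fin ν → AddCircle (2 * Real.pi)

/-- The Hilbert space `L²(ℤ^ν, ℝ^p)` of square summable real vector-valued functions. -/
abbrev SqSum (ν p : ℕ) : Type := lp (fun _ : Lattice ν => EuclideanSpace ℝ (Fin p)) 2

/-! ### Symbols -/

/-- The function `σ ↦ exp (-i ℓᵀσ)` on the torus (see `character_coe`). -/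
def character {ν : ℕ} (ℓ : Lattice ν) : C(Torus ν, ℂ) where
  toFun σ := ∏ k, fourier (-ℓ k) (σ k)
  continuous_toFun := by fun_prop

theorem character_coe {ν : ℕ} (ℓ : Lattice ν) (σ : Fin ν → ℝ) :
    character ℓ (fun k => (σ k : AddCircle (2 * Real.pi))) =
      Complex.exp (-Complex.I * ∑ k, (ℓ k : ℂ) * (σ k : ℂ)) := by
  have hpi : (Real.pi : ℂ) ≠ 0 := by exact_mod_cast Real.pi_ne_zero
  simp only [character, ContinuousMap.coe_mk, fourier_coe_apply, Finset.mul_sum, Complex.exp_sum]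
  refine Finset.prod_congr rfl fun k _ => ?_
  congr 1
  push_cast
  field_simp

/-- The Fourier series `∑_ℓ exp (-i ℓᵀσ) M_ℓ`, entrywise the sum in `L²(𝕋^ν)`. For square
summable `M` the sum converges; as an element of `L²` it is determined up to a null set. -/
def symbol {ν p q : ℕ} (M : Lattice ν → Matrix (Fin p) (Fin q) ℝ) (σ : Torus ν) :
    Matrix (Fin p) (Fin q) ℂ :=
  Matrix.of fun i j =>
    (∑' ℓ, ((M ℓ i j : ℝ) : ℂ) •
      ContinuousMap.toLp 2 (volume : Measure (Torus ν)) ℂ (character ℓ) :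
        Lp ℂ 2 (volume : Measure (Torus ν))) σ

/-- Finiteness of the essential supremum over the torus of the operator norm of the symbol. -/
def BoundedSymbol {ν p q : ℕ} (M : Lattice ν → Matrix (Fin p) (Fin q) ℝ) : Prop :=
  essSup (fun σ : Torus ν => ‖symbol M σ‖ₑ) volume < ⊤

/-- A complex matrix is Hurwitz if all its eigenvalues have negative real parts. -/
def IsHurwitz {n : ℕ} (M : Matrix (Fin n) (Fin n) ℂ) : Prop :=
  ∀ s ∈ spectrum ℂ M, s.re < 0

/-- The spatio-temporal transfer function `F(s,σ) = 𝒞(σ) (s I - 𝒜(σ))⁻¹ ℬ(σ) + 𝒟(σ)`. -/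
def transferFunction {ν n m r : ℕ}
    (A : Lattice ν → Matrix (Fin n) (Fin n) ℝ) (B : Lattice ν → Matrix (Fin n) (Fin m) ℝ)
    (C : Lattice ν → Matrix (Fin r) (Fin n) ℝ) (D : Lattice ν → Matrix (Fin r) (Fin m) ℝ)
    (s : ℂ) (σ : Torus ν) : Matrix (Fin r) (Fin m) ℂ :=
  symbol C σ * (s • (1 : Matrix (Fin n) (Fin n) ℂ) - symbol A σ)⁻¹ * symbol B σ + symbol D σ

/-! ### Network dynamics -/

/-- The block Toeplitz matrix `(M_{j-k})` applied to a function on the lattice: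
`(M f)_j = ∑_k M_{j-k} f_k`. -/
def toeplitz {ν p q : ℕ} (M : Lattice ν → Matrix (Fin p) (Fin q) ℝ)
    (f : Lattice ν → EuclideanSpace ℝ (Fin q)) (j : Lattice ν) : EuclideanSpace ℝ (Fin p) :=
  ∑' k, Matrix.toEuclideanLin (M (j - k)) (f k)

/-- `x` and `y` are the state and the output of the network on `[0, ∞)` for the input `u`: the
state equation is read as a Volterra integral equation at each site of the lattice. -/
structure IsTrajectory {ν n m r : ℕ}
    (A : Lattice ν → Matrix (Fin n) (Fin n) ℝ) (B : Lattice ν → Matrix (Fin n) (Fin m) ℝ)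
    (C : Lattice ν → Matrix (Fin r) (Fin n) ℝ) (D : Lattice ν → Matrix (Fin r) (Fin m) ℝ)
    (u : ℝ → SqSum ν m) (x : ℝ → SqSum ν n) (y : ℝ → SqSum ν r) : Prop where
  continuousOn_state : ContinuousOn x (Set.Ici 0)
  state_eq : ∀ t : ℝ, 0 ≤ t → ∀ j : Lattice ν,
    x t j = x 0 j + ∫ τ in (0 : ℝ)..t, (toeplitz A (x τ) j + toeplitz B (u τ) j)
  output_eq : ∀ t : ℝ, 0 ≤ t → ∀ j : Lattice ν,
    y t j = toeplitz C (x t) j + toeplitz D (u t) j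

/-- Time-local square integrability: `∫₀ᵀ ‖u(t)‖₂² dt < ∞` for every `T > 0`. -/
def LocallySquareIntegrable {ν m : ℕ} (u : ℝ → SqSum ν m) : Prop :=
  ∀ T : ℝ, 0 < T → MemLp u 2 (volume.restrict (Set.Icc 0 T))

/-- The supply rate `⟨u, G y⟩ = ∑_j u_jᵀ ∑_k G_{j-k} y_k`. -/
def supplyRate {ν m r : ℕ} (G : Lattice ν → Matrix (Fin m) (Fin r) ℝ)
    (u : SqSum ν m) (y : SqSum ν r) : ℝ :=
  ∑' j, inner ℝ (u j) (toeplitz G y j)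

/-- Passivity: started at the zero state, every time-locally square integrable input performs
nonnegative work over every time interval `[0, T]`. -/
def IsPassive {ν n m r : ℕ}
    (A : Lattice ν → Matrix (Fin n) (Fin n) ℝ) (B : Lattice ν → Matrix (Fin n) (Fin m) ℝ)
    (C : Lattice ν → Matrix (Fin r) (Fin n) ℝ) (D : Lattice ν → Matrix (Fin r) (Fin m) ℝ)
    (G : Lattice ν → Matrix (Fin m) (Fin r) ℝ) : Prop :=
  ∀ u : ℝ → SqSum ν m, LocallySquareIntegrable u →
    ∀ (x : ℝ → SqSum ν n) (y : ℝ → SqSum ν r), IsTrajectory A B C D u x y → x 0 = 0 →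
      ∀ T : ℝ, 0 < T → 0 ≤ ∫ t in (0 : ℝ)..T, supplyRate G (u t) (y t)

end LatticeNetwork

end

open LatticeNetwork

/-!
Fourier series turn the block Toeplitz operators into multiplication by their symbols. Being real,
they act separately on the real and imaginary parts of the Fourier coefficients, so the network is
passive if and only if the complex system `ẋ = 𝒜 x + ℬ u`, `y = 𝒢 (𝒞 x + 𝒟 u)` on `L²(𝕋^ν)` is.

Suppose that `𝒜` generates an exponentially stable semigroup. By Plancherel's theorem in time the
work done by an input `u` is the integral over all frequencies of `Re ⟪û, 𝒢 F û⟫`. Conversely, the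
response to a harmonic input `exp (iωt) w` is `exp (iωt) z` up to an integrable transient, where
`(iω - 𝒜) z = ℬ w`; hence the work done up to time `T` grows like `T Re ⟪w, 𝒢 F(iω) w⟫`, which
therefore is nonnegative. Choosing `w` supported in small sets localizes this in `σ`.

If `𝒜(σ)` is merely Hurwitz for almost every `σ`, the semigroup need not be exponentially stable.
But it is so over each of the sets where `‖exp (k 𝒜(σ))‖ ≤ 1/2`. These exhaust the torus, the
multiplication system splits over them, and dominated convergence returns passivity on the whole
torus.
-/

noncomputable section

namespace LatticeNetwork

open Set Filter Topology FourierTransform Convolution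

theorem integrable_inner_of_memLp_two {α 𝕜 E : Type*} [MeasurableSpace α] {μ : Measure α}
    [RCLike 𝕜] [NormedAddCommGroup E] [InnerProductSpace 𝕜 E] {f g : α → E} (hf : MemLp f 2 μ)
    (hg : MemLp g 2 μ) : Integrable (fun x => inner 𝕜 (f x) (g x)) μ := by
  refine (L2.integrable_inner (𝕜 := 𝕜) (hf.toLp f) (hg.toLp g)).congr ?_
  filter_upwards [hf.coeFn_toLp, hg.coeFn_toLp] with x h₁ h₂
  rw [h₁, h₂]

/-! ### Plancherel's theorem on `L¹ ∩ L²` -/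

section Plancherel

variable {V F : Type*} [NormedAddCommGroup V] [InnerProductSpace ℝ V] [FiniteDimensional ℝ V]
  [MeasurableSpace V] [BorelSpace V] [NormedAddCommGroup F] [InnerProductSpace ℂ F]
  [CompleteSpace F] {f g : V → F}

theorem coeFn_fourier_toLp (hf₁ : Integrable f) (hf₂ : MemLp f 2) :
    (𝓕 (hf₂.toLp f) : Lp F 2 (volume : Measure V)) =ᵐ[volume] 𝓕 f := by
  have hcont : Continuous (𝓕 f) := VectorFourier.fourierIntegral_continuous
    Real.continuous_fourierChar continuous_inner hf₁
  refine ae_eq_of_integral_contDiff_smul_eq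
    ((Lp.memLp _).locallyIntegrable one_le_two) hcont.locallyIntegrable fun φ hφ hφc => ?_
  have hsupp : HasCompactSupport (Complex.ofRealCLM ∘ φ) := hφc.comp_left rfl
  let ψ : SchwartzMap V ℂ := hsupp.toSchwartzMap (by fun_prop)
  calc ∫ x, φ x • (𝓕 (hf₂.toLp f) : Lp F 2 (volume : Measure V)) x
      = Lp.toTemperedDistribution (𝓕 (hf₂.toLp f)) ψ := by
        simp [Lp.toTemperedDistribution_apply, ψ]
    _ = Lp.toTemperedDistribution (hf₂.toLp f) (𝓕 ψ) := by
        rw [← Lp.fourier_toTemperedDistribution_eq, TemperedDistribution.fourier_apply]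
    _ = ∫ x, 𝓕 (ψ : V → ℂ) x • f x := by
        rw [Lp.toTemperedDistribution_apply]
        refine integral_congr_ae ?_
        filter_upwards [hf₂.coeFn_toLp] with x hx
        rw [hx, SchwartzMap.fourier_coe]
    _ = ∫ x, ψ x • 𝓕 f x := by
        have := VectorFourier.integral_fourierIntegral_smul_eq_flip (L := innerₗ V)
          Real.continuous_fourierChar continuous_inner ψ.integrable hf₁ (μ := volume) (ν := volume)
        rw [flip_innerₗ] at this
        exact this
    _ = ∫ x, φ x • 𝓕 f x := by simp [ψ]

theorem memLp_fourier (hf₁ : Integrable f) (hf₂ : MemLp f 2) : MemLp (𝓕 f) 2 :=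
  (memLp_congr_ae (coeFn_fourier_toLp hf₁ hf₂)).1 (Lp.memLp _)

theorem integral_inner_fourier (hf₁ : Integrable f) (hf₂ : MemLp f 2) (hg₁ : Integrable g)
    (hg₂ : MemLp g 2) : ∫ ξ, inner ℂ (𝓕 f ξ) (𝓕 g ξ) = ∫ x, inner ℂ (f x) (g x) := by
  have h := Lp.inner_fourier_eq (hf₂.toLp f) (hg₂.toLp g)
  simp only [L2.inner_def] at h
  calc ∫ ξ, inner ℂ (𝓕 f ξ) (𝓕 g ξ)
      = ∫ ξ, inner ℂ ((𝓕 (hf₂.toLp f) : Lp F 2 (volume : Measure V)) ξ)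
          ((𝓕 (hg₂.toLp g) : Lp F 2 (volume : Measure V)) ξ) := by
        refine integral_congr_ae ?_
        filter_upwards [coeFn_fourier_toLp hf₁ hf₂, coeFn_fourier_toLp hg₁ hg₂] with ξ h₁ h₂
        rw [h₁, h₂]
    _ = ∫ x, inner ℂ (f x) (g x) := by
        rw [h]
        refine integral_congr_ae ?_
        filter_upwards [hf₂.coeFn_toLp, hg₂.coeFn_toLp] with x h₁ h₂
        rw [h₁, h₂]

end Plancherel

/-! ### Exponentially stable semigroups -/

section Exponential

variable {𝔸 : Type*} [NormedRing 𝔸] [NormedAlgebra ℝ 𝔸]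

/-- Exponential stability of the semigroup `t ↦ exp (t • a)`. -/
def IsExpStable (a : 𝔸) : Prop :=
  ∃ M c : ℝ, 0 < c ∧ ∀ t : ℝ, 0 ≤ t → ‖NormedSpace.exp (t • a)‖ ≤ M * Real.exp (-c * t)

theorem IsExpStable.tendsto_zero {a : 𝔸} (ha : IsExpStable a) :
    Tendsto (fun t : ℝ => NormedSpace.exp (t • a)) atTop (𝓝 0) := by
  obtain ⟨M, c, hc, hM⟩ := ha
  refine squeeze_zero_norm' ((eventually_ge_atTop 0).mono hM) ?_
  have hdecay : Tendsto (fun t : ℝ => Real.exp (-c * t)) atTop (𝓝 0) :=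
    Real.tendsto_exp_atBot.comp (tendsto_id.const_mul_atTop_of_neg (neg_neg_of_pos hc))
  simpa using hdecay.const_mul M

variable [CompleteSpace 𝔸]

theorem exp_add_smul (a : 𝔸) (s t : ℝ) :
    NormedSpace.exp ((s + t) • a) = NormedSpace.exp (s • a) * NormedSpace.exp (t • a) := by
  let : NormedAlgebra ℚ 𝔸 := NormedAlgebra.restrictScalars ℚ ℝ 𝔸
  rw [add_smul]
  exact NormedSpace.exp_add_of_commute (((Commute.refl a).smul_left s).smul_right t)

theorem exp_natCast_mul_smul (a : 𝔸) (s : ℝ) (k : ℕ) :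
    NormedSpace.exp ((k * s) • a) = NormedSpace.exp (s • a) ^ k := by
  induction k with
  | zero => simp
  | succ k ih => rw [Nat.cast_succ, add_mul, one_mul, exp_add_smul, ih, pow_succ]

theorem continuous_exp_smul (a : 𝔸) : Continuous fun t : ℝ => NormedSpace.exp (t • a) :=
  continuous_iff_continuousAt.2 fun t => (hasDerivAt_exp_smul_const a t).continuousAt

theorem isExpStable_of_norm_exp_lt_one {a : 𝔸} {τ : ℝ} (hτ : 0 < τ)
    (h : ‖NormedSpace.exp (τ • a)‖ < 1) : IsExpStable a := by
  obtain ⟨q, hq, hq₁⟩ := exists_between h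
  have hq₀ : 0 < q := (norm_nonneg _).trans_lt hq
  obtain ⟨M, hM⟩ := isCompact_Icc.exists_bound_of_continuousOn (s := Icc 0 τ)
    (continuous_exp_smul a).continuousOn
  have hM₀ : 0 ≤ M := (norm_nonneg _).trans (hM 0 ⟨le_rfl, hτ.le⟩)
  set c := -Real.log q / τ with hc
  have hc₀ : 0 < c := div_pos (neg_pos.2 (Real.log_neg hq₀ hq₁)) hτ
  have hexp : q = Real.exp (-c * τ) := by
    rw [hc, neg_mul, div_mul_cancel₀ _ hτ.ne', neg_neg, Real.exp_log hq₀]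
  refine ⟨M * Real.exp (c * τ), c, hc₀, fun t ht => ?_⟩
  obtain ⟨k, hk₀, hk₁⟩ : ∃ k : ℕ, k * τ ≤ t ∧ t < (k + 1) * τ :=
    ⟨⌊t / τ⌋₊, (le_div_iff₀ hτ).1 (Nat.floor_le (by positivity)),
      (div_lt_iff₀ hτ).1 (Nat.lt_floor_add_one _)⟩
  have hrem : ‖NormedSpace.exp ((t - k * τ) • a)‖ ≤ M := hM _ ⟨by linarith, by linarith⟩
  calc ‖NormedSpace.exp (t • a)‖
      = ‖NormedSpace.exp ((t - k * τ) • a) * NormedSpace.exp (τ • a) ^ k‖ := by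
        rw [← exp_natCast_mul_smul, ← exp_add_smul, sub_add_cancel]
    _ ≤ M * q ^ k := by
        rcases k.eq_zero_or_pos with rfl | hk
        · simpa using hrem
        · exact (norm_mul_le _ _).trans (mul_le_mul hrem ((norm_pow_le' _ hk).trans
            (pow_le_pow_left₀ (norm_nonneg _) hq.le k)) (norm_nonneg _) hM₀)
    _ = M * Real.exp (-c * (k * τ)) := by
        rw [hexp, ← Real.exp_nat_mul]; ring_nf
    _ ≤ M * Real.exp (c * τ + -c * t) := by
        gcongr M * Real.exp ?_
        nlinarith
    _ = M * Real.exp (c * τ) * Real.exp (-c * t) := by rw [Real.exp_add, mul_assoc]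

theorem IsExpStable.integrableOn {a : 𝔸} (ha : IsExpStable a) :
    IntegrableOn (fun t : ℝ => NormedSpace.exp (t • a)) (Ioi 0) := by
  obtain ⟨M, c, hc, hM⟩ := ha
  refine Integrable.mono' ((exp_neg_integrableOn_Ioi 0 hc).const_mul M)
    (continuous_exp_smul a).aestronglyMeasurable ?_
  filter_upwards [ae_restrict_mem measurableSet_Ioi] with t ht using hM t (le_of_lt ht)

theorem IsExpStable.mul_integral_exp {a : 𝔸} (ha : IsExpStable a) :
    a * ∫ t in Ioi (0 : ℝ), NormedSpace.exp (t • a) = -1 := by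
  have hint : IntegrableOn (fun t : ℝ => a * NormedSpace.exp (t • a)) (Ioi 0) :=
    ha.integrableOn.const_mul a
  rw [← integral_const_mul_of_integrable ha.integrableOn,
    integral_Ioi_of_hasDerivAt_of_tendsto' (fun t _ => hasDerivAt_exp_smul_const' a t) hint
      ha.tendsto_zero]
  simp

end Exponential

section Resolvent

variable {𝔸 : Type*} [NormedRing 𝔸] [NormedAlgebra ℂ 𝔸] [CompleteSpace 𝔸] {a : 𝔸}

theorem exp_smul_sub_smul_one (a : 𝔸) (ω t : ℝ) :
    NormedSpace.exp (t • (a - (Complex.I * ω) • (1 : 𝔸))) =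
      Complex.exp (-(Complex.I * ω * t)) • NormedSpace.exp (t • a) := by
  let : NormedAlgebra ℚ 𝔸 := NormedAlgebra.restrictScalars ℚ ℂ 𝔸
  have hscalar : NormedSpace.exp (algebraMap ℂ 𝔸 (-(Complex.I * ω * t))) =
      algebraMap ℂ 𝔸 (Complex.exp (-(Complex.I * ω * t))) := by
    rw [Complex.exp_eq_exp_ℂ, NormedSpace.algebraMap_exp_comm]
  have hsplit : t • (a - (Complex.I * ω) • (1 : 𝔸)) =
      algebraMap ℂ 𝔸 (-(Complex.I * ω * t)) + t • a := by
    rw [Algebra.algebraMap_eq_smul_one, smul_sub, ← Complex.coe_smul t ((_ : ℂ) • (1 : 𝔸)),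
      smul_smul, neg_smul, mul_comm (t : ℂ)]
    abel
  rw [hsplit, NormedSpace.exp_add_of_commute (Algebra.commutes _ _), hscalar, ← Algebra.smul_def]

theorem IsExpStable.sub_smul_one (ha : IsExpStable a) (ω : ℝ) :
    IsExpStable (a - (Complex.I * ω) • (1 : 𝔸)) := by
  obtain ⟨M, c, hc, hM⟩ := ha
  refine ⟨M, c, hc, fun t ht => ?_⟩
  rw [exp_smul_sub_smul_one, norm_smul, Complex.norm_exp]
  simpa using hM t ht

/-- The impulse response of `ẋ = a x + f`: the semigroup generated by `a`, extended by zero to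
negative times. -/
def impulseResponse (a : 𝔸) : ℝ → 𝔸 :=
  (Ioi 0).indicator fun t => NormedSpace.exp (t • a)

theorem IsExpStable.integrable_impulseResponse (ha : IsExpStable a) :
    Integrable (impulseResponse a) :=
  ha.integrableOn.integrable_indicator measurableSet_Ioi

theorem IsExpStable.resolvent_mul_fourier_impulseResponse (ha : IsExpStable a) (ξ : ℝ) :
    ((Complex.I * (2 * Real.pi * ξ : ℝ)) • (1 : 𝔸) - a) * 𝓕 (impulseResponse a) ξ = 1 := by
  have hfourier : 𝓕 (impulseResponse a) ξ =
      ∫ t in Ioi (0 : ℝ),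
        NormedSpace.exp (t • (a - (Complex.I * (2 * Real.pi * ξ : ℝ)) • (1 : 𝔸))) := by
    rw [Real.fourier_eq', ← integral_indicator measurableSet_Ioi]
    refine integral_congr_ae (Eventually.of_forall fun t => ?_)
    by_cases ht : t ∈ Ioi (0 : ℝ)
    · simp only [impulseResponse, indicator_of_mem ht, exp_smul_sub_smul_one]
      congr 2
      simp
      ring
    · simp only [impulseResponse, indicator_of_notMem ht, smul_zero]
  rw [hfourier, ← neg_sub a, neg_mul, (ha.sub_smul_one _).mul_integral_exp, neg_neg]

end Resolvent

/-! ### Linear state equations in a Banach space -/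

section StateEquation

theorem intervalIntegrable_clm_apply {𝕜 E F : Type*} [RCLike 𝕜] [NormedAddCommGroup E]
    [NormedSpace 𝕜 E] [NormedAddCommGroup F] [NormedSpace 𝕜 F] {K : ℝ → E →L[𝕜] F}
    (hK : Continuous K) {g : ℝ → E} {s t : ℝ} (hg : IntervalIntegrable g volume s t) :
    IntervalIntegrable (fun r => K r (g r)) volume s t := by
  obtain ⟨C, hC⟩ := isCompact_uIcc.exists_bound_of_continuousOn (s := uIcc s t) hK.continuousOn
  rw [intervalIntegrable_iff] at hg ⊢
  refine (ContinuousLinearMap.id 𝕜 (E →L[𝕜] F)).integrable_of_bilin_of_bdd_left C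
    hK.aestronglyMeasurable ?_ hg
  filter_upwards [ae_restrict_mem measurableSet_uIoc] with r hr using hC r (uIoc_subset_uIcc hr)

theorem intervalIntegral_apply_primitive {𝕜 E F : Type*} [RCLike 𝕜] [NormedAddCommGroup E]
    [NormedSpace ℝ E] [NormedSpace 𝕜 E] [CompleteSpace E] [NormedAddCommGroup F] [NormedSpace ℝ F]
    [NormedSpace 𝕜 F] [CompleteSpace F] {K : ℝ → E →L[𝕜] F} (hK : Continuous K) {g : ℝ → E} {t : ℝ}
    (ht : 0 ≤ t) (hg : IntegrableOn g (Ioc 0 t)) :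
    ∫ s in (0 : ℝ)..t, K s (∫ r in (0 : ℝ)..s, g r) =
      ∫ r in (0 : ℝ)..t, (∫ s in r..t, K s) (g r) := by
  let Φ : ℝ → ℝ → F := fun s r => (Ici r).indicator (fun s => K s (g r)) s
  have hΦ : IntegrableOn Φ.uncurry (uIoc 0 t ×ˢ uIoc 0 t) := by
    rw [uIoc_of_le ht, IntegrableOn, Measure.volume_eq_prod, ← Measure.prod_restrict]
    have hKint : IntegrableOn K (Ioc 0 t) := (hK.integrableOn_Icc).mono_set Ioc_subset_Icc_self
    have hprod := hKint.op_fst_snd (op := fun (k : E →L[𝕜] F) x => k x) (by fun_prop)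
      ⟨1, fun k x => by simpa using k.le_opNorm x⟩ hg
    exact hprod.indicator (measurableSet_le measurable_snd measurable_fst)
  calc ∫ s in (0 : ℝ)..t, K s (∫ r in (0 : ℝ)..s, g r)
      = ∫ s in (0 : ℝ)..t, ∫ r in (0 : ℝ)..t, Φ s r := by
        refine intervalIntegral.integral_congr fun s hs => ?_
        rw [uIcc_of_le ht] at hs
        have hgs : IntervalIntegrable g volume 0 s :=
          (intervalIntegrable_iff_integrableOn_Ioc_of_le hs.1).2
            (hg.mono_set (Ioc_subset_Ioc_right hs.2))
        exact ((K s).intervalIntegral_comp_comm hgs).symm.trans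
          (intervalIntegral.integral_indicator hs).symm
    _ = ∫ r in (0 : ℝ)..t, ∫ s in (0 : ℝ)..t, Φ s r :=
        intervalIntegral_intervalIntegral_swap hΦ
    _ = ∫ r in (0 : ℝ)..t, (∫ s in r..t, K s) (g r) := by
        refine intervalIntegral.integral_congr_ae (Eventually.of_forall fun r hr => ?_)
        rw [uIoc_of_le ht] at hr
        have hinter : Ioc 0 t ∩ Ici r = Icc r t := by
          ext s; simp only [mem_inter_iff, mem_Ioc, mem_Ici, mem_Icc]; grind
        have hKr : IntegrableOn K (Ioc r t) := (hK.intervalIntegrable r t).1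
        rw [intervalIntegral.integral_of_le ht, intervalIntegral.integral_of_le hr.2,
          ContinuousLinearMap.integral_apply hKr, setIntegral_indicator measurableSet_Ici, hinter,
          integral_Icc_eq_integral_Ioc]

/-- `x` solves `ẋ = a x + f`, `x(0) = 0`, on `[0, T]` in the sense of the integral equation. -/
structure SolvesStateEquation {H : Type*} [NormedAddCommGroup H] [NormedSpace ℝ H] (a : H → H)
    (f x : ℝ → H) (T : ℝ) : Prop where
  continuousOn : ContinuousOn x (Icc 0 T)
  integrableOn : IntegrableOn f (Ioc 0 T)
  eq_integral : ∀ t ∈ Icc 0 T, x t = ∫ s in (0 : ℝ)..t, (a (x s) + f s)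

theorem intervalIntegrable_stateEquation {H : Type*} [NormedAddCommGroup H] {a : H → H}
    {f x : ℝ → H} {T t : ℝ} (ha : Continuous a) (hx : ContinuousOn x (Icc 0 T))
    (hf : IntegrableOn f (Ioc 0 T)) (ht : t ∈ Icc 0 T) :
    IntervalIntegrable (fun s => a (x s) + f s) volume 0 t := by
  refine .add (ContinuousOn.intervalIntegrable_of_Icc ht.1 ?_) ?_
  · exact ha.comp_continuousOn (hx.mono (Icc_subset_Icc_right ht.2))
  · exact (intervalIntegrable_iff_integrableOn_Ioc_of_le ht.1).2
      (hf.mono_set (Ioc_subset_Ioc_right ht.2))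

theorem SolvesStateEquation.map {𝕜 H H' : Type*} [RCLike 𝕜] [NormedAddCommGroup H]
    [NormedSpace ℝ H] [NormedSpace 𝕜 H] [CompleteSpace H] [NormedAddCommGroup H']
    [NormedSpace ℝ H'] [NormedSpace 𝕜 H'] [CompleteSpace H'] {a : H → H} {a' : H' → H'}
    {f x : ℝ → H} {T : ℝ} (h : SolvesStateEquation a f x T) (ha : Continuous a) {W : H →L[𝕜] H'}
    (haW : ∀ z, W (a z) = a' (W z)) :
    SolvesStateEquation a' (fun t => W (f t)) (fun t => W (x t)) T := by
  refine ⟨W.continuous.comp_continuousOn h.continuousOn, W.integrable_comp h.integrableOn,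
    fun t ht => ?_⟩
  simp only [h.eq_integral t ht, ← haW, ← map_add]
  exact (W.intervalIntegral_comp_comm
    (intervalIntegrable_stateEquation ha h.continuousOn h.integrableOn ht)).symm

variable {H : Type*} [NormedAddCommGroup H] [NormedSpace ℂ H]

theorem integral_exp_sub_smul [CompleteSpace H] (a : H →L[ℂ] H) (r t : ℝ) :
    ∫ s in r..t, NormedSpace.exp ((t - s) • a) * a = NormedSpace.exp ((t - r) • a) - 1 := by
  rw [intervalIntegral.integral_comp_sub_left (fun s => NormedSpace.exp (s • a) * a) t,
    sub_self, intervalIntegral.integral_eq_sub_of_hasDerivAt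
      (fun s _ => hasDerivAt_exp_smul_const a s)
      (((continuous_exp_smul a).mul continuous_const).intervalIntegrable _ _)]
  simp

theorem SolvesStateEquation.eq_integral_exp [CompleteSpace H] {a : H →L[ℂ] H} {f x : ℝ → H}
    {T t : ℝ} (h : SolvesStateEquation a f x T) (ht : t ∈ Icc 0 T) :
    x t = ∫ s in (0 : ℝ)..t, NormedSpace.exp ((t - s) • a) (f s) := by
  let E : ℝ → H →L[ℂ] H := fun s => NormedSpace.exp ((t - s) • a)
  let g : ℝ → H := fun s => a (x s) + f s
  have hE : Continuous E := (continuous_exp_smul a).comp (by fun_prop)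
  have hx : IntervalIntegrable (fun s => a (x s)) volume 0 t := by
    refine ContinuousOn.intervalIntegrable_of_Icc ht.1 ?_
    exact a.continuous.comp_continuousOn (h.continuousOn.mono (Icc_subset_Icc_right ht.2))
  have hf : IntervalIntegrable f volume 0 t :=
    (intervalIntegrable_iff_integrableOn_Ioc_of_le ht.1).2
      (h.integrableOn.mono_set (Ioc_subset_Ioc_right ht.2))
  have hg : IntervalIntegrable g volume 0 t := hx.add hf
  have hstate : ∫ s in (0 : ℝ)..t, E s (a (x s)) = (∫ s in (0 : ℝ)..t, E s (g s)) - x t := by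
    calc ∫ s in (0 : ℝ)..t, E s (a (x s))
        = ∫ s in (0 : ℝ)..t, (E s * a) (∫ r in (0 : ℝ)..s, g r) := by
          refine intervalIntegral.integral_congr fun s hs => ?_
          rw [uIcc_of_le ht.1] at hs
          simp only [ContinuousLinearMap.mul_def, ContinuousLinearMap.comp_apply, g,
            h.eq_integral s ⟨hs.1, hs.2.trans ht.2⟩]
      _ = ∫ r in (0 : ℝ)..t, (∫ s in r..t, E s * a) (g r) :=
          intervalIntegral_apply_primitive (hE.mul continuous_const) ht.1 hg.1
      _ = ∫ r in (0 : ℝ)..t, (E r (g r) - g r) := by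
          simp only [E, integral_exp_sub_smul, sub_apply, one_apply_eq_self]
      _ = (∫ s in (0 : ℝ)..t, E s (g s)) - x t := by
          rw [intervalIntegral.integral_sub (intervalIntegrable_clm_apply hE hg) hg,
            h.eq_integral t ht]
  have hsplit : ∫ s in (0 : ℝ)..t, E s (g s) =
      (∫ s in (0 : ℝ)..t, E s (a (x s))) + ∫ s in (0 : ℝ)..t, E s (f s) := by
    simp only [g, map_add]
    exact intervalIntegral.integral_add (intervalIntegrable_clm_apply hE hx)
      (intervalIntegrable_clm_apply hE hf)
  rw [hstate, sub_add_eq_add_sub, eq_sub_iff_add_eq] at hsplit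
  exact add_left_cancel hsplit

end StateEquation

/-! ### Supply inequalities in the time domain and in the frequency domain -/

section Supply

theorem fourier_clm_apply {V E F : Type*} [NormedAddCommGroup V] [InnerProductSpace ℝ V]
    [FiniteDimensional ℝ V] [MeasurableSpace V] [BorelSpace V] [NormedAddCommGroup E]
    [NormedSpace ℂ E] [CompleteSpace E] [NormedAddCommGroup F] [NormedSpace ℂ F] [CompleteSpace F]
    (L : E →L[ℂ] F) {f : V → E} (hf : Integrable f) (ξ : V) :
    𝓕 (fun x => L (f x)) ξ = L (𝓕 f ξ) := by
  rw [Real.fourier_eq, Real.fourier_eq,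
    ← L.integral_comp_comm ((Real.fourierIntegral_convergent_iff ξ).2 hf)]
  simp only [Circle.smul_def, map_smul]

section Response

variable {H : Type*} [NormedAddCommGroup H] [NormedSpace ℂ H] {a : H →L[ℂ] H} {f : ℝ → H}

theorem IsExpStable.exists_norm_impulseResponse_le (ha : IsExpStable a) :
    ∃ M, ∀ t, ‖impulseResponse a t‖ ≤ M := by
  obtain ⟨M, c, hc, hM⟩ := ha
  have hM₀ : 0 ≤ M := by simpa using (norm_nonneg _).trans (hM 0 le_rfl)
  refine ⟨M, fun t => ?_⟩
  by_cases ht : t ∈ Ioi (0 : ℝ)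
  · rw [impulseResponse, indicator_of_mem ht]
    exact (hM t (le_of_lt ht)).trans
      (mul_le_of_le_one_right hM₀ (Real.exp_le_one_iff.2 (by nlinarith [mem_Ioi.1 ht])))
  · simpa [impulseResponse, ht] using hM₀

variable [CompleteSpace H]

/-- The response `∫ impulseResponse a (t - s) (f s) ds` of `ẋ = a x + f` to a forcing on the
whole time axis. -/
def response (a : H →L[ℂ] H) (f : ℝ → H) : ℝ → H :=
  impulseResponse a ⋆[ContinuousLinearMap.id ℂ (H →L[ℂ] H)] f

theorem IsExpStable.integrable_response (ha : IsExpStable a) (hf : Integrable f) :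
    Integrable (response a f) :=
  ha.integrable_impulseResponse.integrable_convolution _ hf

theorem IsExpStable.memLp_response (ha : IsExpStable a) (hf : Integrable f) :
    MemLp (response a f) 2 := by
  obtain ⟨M, hM⟩ := ha.exists_norm_impulseResponse_le
  have hbound (t : ℝ) : ‖response a f t‖ ≤ M * ∫ s, ‖f s‖ := by
    rw [response, convolution_eq_swap, ← integral_const_mul]
    exact norm_integral_le_of_norm_le (hf.norm.const_mul M)
      (Eventually.of_forall fun s => ContinuousLinearMap.le_of_opNorm_le _ (hM _) _)
  have hint := ha.integrable_response hf
  refine (memLp_two_iff_integrable_sq_norm hint.1).2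
    (Integrable.mono' (hint.norm.const_mul (M * ∫ s, ‖f s‖)) (hint.1.norm.pow 2)
      (Eventually.of_forall fun t => ?_))
  rw [Real.norm_of_nonneg (by positivity), sq]
  exact mul_le_mul_of_nonneg_right (hbound t) (norm_nonneg _)

theorem IsExpStable.fourier_response (ha : IsExpStable a) (hf : Integrable f) (ξ : ℝ) :
    (Complex.I * (2 * Real.pi * ξ : ℝ)) • 𝓕 (response a f) ξ - a (𝓕 (response a f) ξ) =
      𝓕 f ξ := by
  have hconv : 𝓕 (response a f) ξ = 𝓕 (impulseResponse a) ξ (𝓕 f ξ) :=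
    Real.fourier_bilin_convolution_eq _ ha.integrable_impulseResponse hf ξ
  have hres := congrArg (fun L : H →L[ℂ] H => L (𝓕 f ξ))
    (ha.resolvent_mul_fourier_impulseResponse ξ)
  simpa [hconv] using hres

theorem SolvesStateEquation.eq_response {x : ℝ → H} {T t : ℝ} (h : SolvesStateEquation a f x T)
    (ht : t ∈ Icc 0 T) : x t = response a ((Ioc 0 T).indicator f) t := by
  rw [h.eq_integral_exp ht, response, convolution_eq_swap, intervalIntegral.integral_of_le ht.1,
    integral_Ioc_eq_integral_Ioo, ← integral_indicator measurableSet_Ioo]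
  congr with s
  by_cases hs : s ∈ Ioo 0 t
  · have hs' : s ∈ Ioc 0 T := ⟨hs.1, hs.2.le.trans ht.2⟩
    simp [impulseResponse, hs, hs', hs.2]
  · have hs' : s ∉ Ioc 0 T ∨ t - s ∉ Ioi 0 := by
      simp only [mem_Ioo, mem_Ioc, mem_Ioi] at hs ⊢
      grind
    rcases hs' with hs' | hs' <;> simp only [impulseResponse, indicator_of_notMem hs,
      indicator_of_notMem hs', map_zero, zero_apply]

end Response

variable {E H : Type*} [NormedAddCommGroup E] [InnerProductSpace ℂ E]
  [NormedAddCommGroup H] [InnerProductSpace ℂ H]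
  {a : H →L[ℂ] H} {b : E →L[ℂ] H} {c : H →L[ℂ] E} {d : E →L[ℂ] E}

theorem re_inner_phase_smul {e : ℂ} (he : ‖e‖ = 1) (w : E) (y z : H) :
    (inner ℂ (e • w) (c (e • z - y) + d (e • w))).re =
      (inner ℂ w (c z + d w)).re - (inner ℂ (e • w) (c y)).re := by
  have hphase : inner ℂ (e • w) (e • (c z + d w)) = inner ℂ w (c z + d w) := by
    rw [inner_smul_left, inner_smul_right, ← mul_assoc, Complex.conj_mul', he]
    simp only [Complex.ofReal_one, one_pow, one_mul]
  rw [← hphase, ← Complex.sub_re, ← inner_sub_right]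
  simp only [map_sub, map_smul, smul_add, sub_add_eq_add_sub]

theorem re_inner_phase_smul_le {e : ℂ} (he : ‖e‖ = 1) (w : E) (S : H →L[ℂ] H) (z : H) :
    (inner ℂ (e • w) (c (e • z - S z) + d (e • w))).re ≤
      (inner ℂ w (c z + d w)).re + ‖w‖ * (‖c‖ * (‖S‖ * ‖z‖)) := by
  rw [re_inner_phase_smul he, sub_eq_add_neg, ← Complex.neg_re]
  gcongr
  refine (Complex.re_le_norm _).trans ?_
  rw [norm_neg]
  refine (norm_inner_le_norm _ _).trans ?_
  rw [norm_smul, he, one_mul]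
  gcongr
  exact c.le_opNorm_of_le (S.le_opNorm z)

theorem nonneg_of_forall_mul_add_nonneg {κ K : ℝ} (h : ∀ T : ℝ, 0 < T → 0 ≤ T * κ + K) :
    0 ≤ κ := by
  by_contra! hneg
  have hlarge := h ((|K| + 1) / -κ) (div_pos (by positivity) (neg_pos.2 hneg))
  rw [div_neg, neg_mul, div_mul_cancel₀ _ hneg.ne] at hlarge
  linarith [le_abs_self K]

variable [CompleteSpace H]

theorem IsExpStable.integral_re_inner_response_nonneg [CompleteSpace E] (ha : IsExpStable a)
    (hpos : ∀ (ω : ℝ) (z : H) (w : E), (Complex.I * ω) • z - a z = b w →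
      0 ≤ (inner ℂ w (c z + d w)).re)
    {u : ℝ → E} (hu₁ : Integrable u) (hu₂ : MemLp u 2) :
    0 ≤ ∫ t, (inner ℂ (u t) (c (response a (fun t => b (u t)) t) + d (u t))).re := by
  set x := response a (fun t => b (u t)) with hx
  have hbu : Integrable fun t => b (u t) := b.integrable_comp hu₁
  have hx₁ : Integrable x := ha.integrable_response hbu
  have hx₂ : MemLp x 2 := ha.memLp_response hbu
  have hy₁ : Integrable fun t => c (x t) + d (u t) :=
    (c.integrable_comp hx₁).add (d.integrable_comp hu₁)
  have hy₂ : MemLp (fun t => c (x t) + d (u t)) 2 := (c.comp_memLp' hx₂).add (d.comp_memLp' hu₂)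
  have hfourier (ξ : ℝ) : 𝓕 (fun t => c (x t) + d (u t)) ξ = c (𝓕 x ξ) + d (𝓕 u ξ) := by
    rw [← fourier_clm_apply c hx₁, ← fourier_clm_apply d hu₁]
    exact congrFun (VectorFourier.fourierIntegral_add Real.continuous_fourierChar continuous_inner
      (c.integrable_comp hx₁) (d.integrable_comp hu₁)) ξ
  have hstate (ξ : ℝ) : (Complex.I * (2 * Real.pi * ξ : ℝ)) • 𝓕 x ξ - a (𝓕 x ξ) = b (𝓕 u ξ) := by
    rw [hx, ha.fourier_response hbu, fourier_clm_apply b hu₁]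
  have hre {f g : ℝ → E} (hf : MemLp f 2) (hg : MemLp g 2) :
      ∫ t, (inner ℂ (f t) (g t)).re = (∫ t, inner ℂ (f t) (g t)).re := by
    simpa using! integral_re (𝕜 := ℂ) (integrable_inner_of_memLp_two hf hg)
  rw [hre hu₂ hy₂, ← integral_inner_fourier hu₁ hu₂ hy₁ hy₂,
    ← hre (memLp_fourier hu₁ hu₂) (memLp_fourier hy₁ hy₂)]
  refine integral_nonneg fun ξ => ?_
  rw [Pi.zero_apply, hfourier]
  exact hpos _ _ _ (hstate ξ)

theorem SolvesStateEquation.integral_re_inner_nonneg [CompleteSpace E] (ha : IsExpStable a)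
    (hpos : ∀ (ω : ℝ) (z : H) (w : E), (Complex.I * ω) • z - a z = b w →
      0 ≤ (inner ℂ w (c z + d w)).re)
    {T : ℝ} (hT : 0 ≤ T) {u : ℝ → E} (hu : MemLp u 2 (volume.restrict (Ioc 0 T))) {x : ℝ → H}
    (hx : SolvesStateEquation a (fun t => b (u t)) x T) :
    0 ≤ ∫ t in (0 : ℝ)..T, (inner ℂ (u t) (c (x t) + d (u t))).re := by
  set v := (Ioc 0 T).indicator u with hv
  have hv₂ : MemLp v 2 := (memLp_indicator_iff_restrict measurableSet_Ioc).2 hu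
  have hv₁ : Integrable v :=
    (integrable_indicator_iff measurableSet_Ioc).2 (hu.integrable one_le_two)
  have hbv : (Ioc 0 T).indicator (fun t => b (u t)) = fun t => b (v t) := by
    ext t
    by_cases ht : t ∈ Ioc 0 T <;> simp [hv, ht]
  convert ha.integral_re_inner_response_nonneg hpos hv₁ hv₂ using 1
  rw [intervalIntegral.integral_of_le hT, ← integral_indicator measurableSet_Ioc]
  congr with t
  by_cases ht : t ∈ Ioc 0 T
  · simp [hv, ht, hx.eq_response (Ioc_subset_Icc_self ht), hbv]
  · simp [hv, ht]

theorem solvesStateEquation_harmonic (a : H →L[ℂ] H) (ω : ℝ) (z : H) (T : ℝ) :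
    SolvesStateEquation a (fun t => Complex.exp (Complex.I * ω * t) • ((Complex.I * ω) • z - a z))
      (fun t => Complex.exp (Complex.I * ω * t) • z - NormedSpace.exp (t • a) z) T := by
  set x : ℝ → H := fun t => Complex.exp (Complex.I * ω * t) • z - NormedSpace.exp (t • a) z with hx
  set f : ℝ → H := fun t => Complex.exp (Complex.I * ω * t) • ((Complex.I * ω) • z - a z) with hf
  have hderiv (t : ℝ) : HasDerivAt x (a (x t) + f t) t := by
    have hphase : HasDerivAt (fun t : ℝ => Complex.exp (Complex.I * ω * t))
        (Complex.exp (Complex.I * ω * t) * (Complex.I * ω)) t := by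
      simpa using ((hasDerivAt_id (t : ℂ)).const_mul (Complex.I * ω)).cexp.comp_ofReal
    have hexp : HasDerivAt (fun t : ℝ => NormedSpace.exp (t • a) z)
        (a (NormedSpace.exp (t • a) z)) t :=
      ((ContinuousLinearMap.apply ℂ H z).restrictScalars ℝ).hasFDerivAt.comp_hasDerivAt t
        (hasDerivAt_exp_smul_const' a t)
    refine ((hphase.smul_const z).sub hexp).congr_deriv ?_
    simp only [hx, hf, map_sub, map_smul, smul_sub, mul_smul]
    abel
  have hxc : Continuous x := continuous_iff_continuousAt.2 fun t => (hderiv t).continuousAt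
  have hfc : Continuous f := by fun_prop
  refine ⟨hxc.continuousOn, hfc.integrableOn_Ioc, fun t _ => ?_⟩
  rw [intervalIntegral.integral_eq_sub_of_hasDerivAt (fun s _ => hderiv s)
    (((a.continuous.comp hxc).add hfc).intervalIntegrable _ _)]
  simp [hx]

theorem IsExpStable.re_inner_nonneg_of_integral_nonneg (ha : IsExpStable a) {ω : ℝ} {z : H} {w : E}
    (hpos : ∀ T : ℝ, 0 < T → 0 ≤ ∫ t in (0 : ℝ)..T,
      (inner ℂ (Complex.exp (Complex.I * ω * t) • w)
        (c (Complex.exp (Complex.I * ω * t) • z - NormedSpace.exp (t • a) z) +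
          d (Complex.exp (Complex.I * ω * t) • w))).re) :
    0 ≤ (inner ℂ w (c z + d w)).re := by
  set κ := (inner ℂ w (c z + d w)).re
  let transient (t : ℝ) : ℝ := ‖w‖ * (‖c‖ * (‖NormedSpace.exp (t • a)‖ * ‖z‖))
  have htransient : Continuous transient := by
    have hexp := continuous_exp_smul a
    fun_prop
  have hint : IntegrableOn transient (Ioi 0) :=
    ((ha.integrableOn.norm.mul_const _).const_mul _).const_mul _
  have hphase (t : ℝ) : ‖Complex.exp (Complex.I * ω * t)‖ = 1 := by simp [Complex.norm_exp]
  refine nonneg_of_forall_mul_add_nonneg (K := ∫ t in Ioi (0 : ℝ), transient t) fun T hT => ?_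
  calc 0 ≤ ∫ t in (0 : ℝ)..T, (κ + transient t) := by
        have hexp := continuous_exp_smul a
        exact (hpos T hT).trans (intervalIntegral.integral_mono_on hT.le
          (Continuous.intervalIntegrable (by fun_prop) _ _)
          ((continuous_const.add htransient).intervalIntegrable _ _)
          fun t _ => re_inner_phase_smul_le (hphase t) w _ z)
    _ = T * κ + ∫ t in Ioc 0 T, transient t := by
        rw [intervalIntegral.integral_add intervalIntegrable_const
          (htransient.intervalIntegrable _ _), intervalIntegral.integral_const, sub_zero,
          smul_eq_mul, intervalIntegral.integral_of_le hT.le]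
    _ ≤ T * κ + ∫ t in Ioi (0 : ℝ), transient t := by
        have hnonneg (t : ℝ) : 0 ≤ transient t := by positivity
        exact add_le_add le_rfl (setIntegral_mono_set hint (Eventually.of_forall hnonneg)
          Ioc_subset_Ioi_self.eventuallyLE)

end Supply

/-! ### The exponential of a Hurwitz matrix -/

section Hurwitz

variable {ι : Type*} [Fintype ι] [DecidableEq ι]

theorem exp_mulVec_of_mulVec_eq_smul {A : Matrix ι ι ℂ} {z : ℂ} {v : ι → ℂ}
    (h : A.mulVec v = z • v) : (NormedSpace.exp A).mulVec v = Complex.exp z • v := by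
  have hpow (k : ℕ) : (A ^ k).mulVec v = z ^ k • v := by
    induction k with
    | zero => simp
    | succ k ih =>
      rw [pow_succ', ← Matrix.mulVec_mulVec, ih, Matrix.mulVec_smul, h, smul_smul, pow_succ]
  have hmatrix := (NormedSpace.exp_series_hasSum_exp' (𝕂 := ℂ) A).map
    ((Matrix.mulVecBilin ℂ ℂ).flip v : Matrix ι ι ℂ →ₗ[ℂ] (ι → ℂ))
    (LinearMap.continuous_of_finiteDimensional _)
  have hscalar := (NormedSpace.exp_series_hasSum_exp' (𝕂 := ℂ) z).smul_const v
  rw [← Complex.exp_eq_exp_ℂ] at hscalar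
  exact hmatrix.unique (hscalar.congr_fun fun k => by simp [hpow, smul_smul])

-- The eigenspaces of `exp A` are invariant under `A`, hence contain eigenvectors of `A`.
theorem spectrum_exp_subset (A : Matrix ι ι ℂ) :
    spectrum ℂ (NormedSpace.exp A) ⊆ Complex.exp '' spectrum ℂ A := by
  intro z hz
  have hcomm : Commute (NormedSpace.exp A).toLin' A.toLin' :=
    ((Commute.refl A).exp_left).map (Matrix.toLinAlgEquiv' (R := ℂ) (n := ι))
  rw [← Matrix.spectrum_toLin', ← Module.End.hasEigenvalue_iff_mem_spectrum] at hz
  set W := Module.End.eigenspace (NormedSpace.exp A).toLin' z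
  have hmaps : MapsTo A.toLin' W W := Module.End.mapsTo_genEigenspace_of_comm hcomm z 1
  have : Nontrivial W := Submodule.nontrivial_iff_ne_bot.2 hz
  obtain ⟨s, hs⟩ := Module.End.exists_eigenvalue (A.toLin'.restrict hmaps)
  obtain ⟨⟨v, hvW⟩, hv⟩ := hs.exists_hasEigenvector
  have hv₀ : v ≠ 0 := fun h => hv.2 (Subtype.ext h)
  have hAv : A.toLin' v = s • v := congrArg Subtype.val hv.apply_eq_smul
  have hexp : (NormedSpace.exp A).mulVec v = z • v := Module.End.mem_eigenspace_iff.1 hvW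
  refine ⟨s, ?_, ?_⟩
  · rw [← Matrix.spectrum_toLin', ← Module.End.hasEigenvalue_iff_mem_spectrum]
    exact Module.End.hasEigenvalue_of_hasEigenvector
      (Module.End.hasEigenvector_iff.2 ⟨Module.End.mem_eigenspace_iff.2 hAv, hv₀⟩)
  · rw [exp_mulVec_of_mulVec_eq_smul (Matrix.toLin'_apply A v ▸ hAv)] at hexp
    exact smul_left_injective ℂ hv₀ hexp

theorem tendsto_pow_zero_of_spectralRadius_lt_one {𝔸 : Type*} [NormedRing 𝔸] [NormedAlgebra ℂ 𝔸]
    [CompleteSpace 𝔸] {a : 𝔸} (ha : spectralRadius ℂ a < 1) :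
    Tendsto (fun k : ℕ => a ^ k) atTop (𝓝 0) := by
  obtain ⟨q, hq, hq₁⟩ := ENNReal.lt_iff_exists_nnreal_btwn.1 ha
  have hroot := (spectrum.pow_nnnorm_pow_one_div_tendsto_nhds_spectralRadius a).eventually
    (gt_mem_nhds hq)
  refine squeeze_zero_norm' ?_ (tendsto_pow_atTop_nhds_zero_of_lt_one q.2 (by exact_mod_cast hq₁))
  filter_upwards [hroot, eventually_gt_atTop 0] with k hk hk₀
  have hpow := ENNReal.rpow_le_rpow hk.le (Nat.cast_nonneg (α := ℝ) k)
  rw [← ENNReal.rpow_mul, one_div, inv_mul_cancel₀ (by positivity), ENNReal.rpow_one,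
    ENNReal.rpow_natCast] at hpow
  exact_mod_cast hpow

variable {n : ℕ} {A : Matrix (Fin n) (Fin n) ℂ}

theorem IsHurwitz.tendsto_exp_natCast_smul (hA : IsHurwitz A) :
    Tendsto (fun k : ℕ => NormedSpace.exp ((k : ℝ) • A)) atTop (𝓝 0) := by
  rcases subsingleton_or_nontrivial (Matrix (Fin n) (Fin n) ℂ) with hsub | hnontrivial
  · simp [Subsingleton.elim _ (0 : Matrix (Fin n) (Fin n) ℂ)]
  have hradius : spectralRadius ℂ (NormedSpace.exp A) < (1 : NNReal) := by
    refine spectrum.spectralRadius_lt_of_forall_lt _ fun z hz => ?_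
    obtain ⟨s, hs, rfl⟩ := spectrum_exp_subset A hz
    rw [← NNReal.coe_lt_coe, coe_nnnorm, Complex.norm_exp, NNReal.coe_one, Real.exp_lt_one_iff]
    exact hA s hs
  have hpow (k : ℕ) : NormedSpace.exp ((k : ℝ) • A) = NormedSpace.exp A ^ k := by
    simpa using exp_natCast_mul_smul A 1 k
  simpa only [hpow] using tendsto_pow_zero_of_spectralRadius_lt_one hradius

theorem IsHurwitz.isUnit_det_smul_one_sub (hA : IsHurwitz A) (ω : ℝ) :
    IsUnit ((Complex.I * ω) • (1 : Matrix (Fin n) (Fin n) ℂ) - A).det := by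
  rw [← Matrix.isUnit_iff_isUnit_det, ← Algebra.algebraMap_eq_smul_one]
  by_contra hmem
  simpa using hA _ (spectrum.mem_iff.2 hmem)

end Hurwitz

/-! ### Multiplication operators on `L²` -/

section Multiplication

variable {Ω : Type*} [MeasurableSpace Ω] {μ : Measure Ω} {ι κ : Type*} [Fintype ι] [Fintype κ]
  [DecidableEq κ]

variable (ι κ) in
/-- Matrix-vector multiplication as a continuous bilinear map. -/
def matrixAction : Matrix ι κ ℂ →L[ℂ] EuclideanSpace ℂ κ →L[ℂ] EuclideanSpace ℂ ι :=
  LinearMap.toContinuousLinearMap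
    ((Matrix.toEuclideanLin (𝕜 := ℂ) (m := ι) (n := κ)).trans
      LinearMap.toContinuousLinearMap : Matrix ι κ ℂ →ₗ[ℂ] _)

/-- Multiplication by a bounded matrix-valued function, as an operator on `L²`. -/
def mulOp {S : Ω → Matrix ι κ ℂ} (hS : MemLp S ⊤ μ) :
    Lp (EuclideanSpace ℂ κ) 2 μ →L[ℂ] Lp (EuclideanSpace ℂ ι) 2 μ :=
  (matrixAction ι κ).holderL μ ⊤ 2 2 (hS.toLp S)

theorem coeFn_mulOp {S : Ω → Matrix ι κ ℂ} (hS : MemLp S ⊤ μ) (f : Lp (EuclideanSpace ℂ κ) 2 μ) :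
    mulOp hS f =ᵐ[μ] fun σ => Matrix.toEuclideanLin (S σ) (f σ) := by
  filter_upwards [(matrixAction ι κ).coeFn_holder (r := 2) (hS.toLp S) f, hS.coeFn_toLp]
    with σ hholder hS
  exact hholder.trans (by rw [hS]; rfl)

section Product

variable {τ : Type*} [Fintype τ] [DecidableEq τ] {R : Ω → Matrix ι κ ℂ} {S : Ω → Matrix κ τ ℂ}

theorem memLp_top_matrix_mul (hR : MemLp R ⊤ μ) (hS : MemLp S ⊤ μ) :
    MemLp (fun σ => R σ * S σ) ⊤ μ := by
  refine MemLp.of_bilin (r := ⊤) (fun M N => M * N) 1 hR hS ?_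
    (ae_of_all _ fun σ => by simpa using Matrix.l2_opNNNorm_mul (R σ) (S σ))
  exact (continuous_fst.matrix_mul continuous_snd).comp_aestronglyMeasurable
    (hR.1.prodMk hS.1)

theorem mulOp_mul (hR : MemLp R ⊤ μ) (hS : MemLp S ⊤ μ) :
    mulOp (memLp_top_matrix_mul hR hS) = mulOp hR ∘L mulOp hS := by
  refine ContinuousLinearMap.ext fun f => Lp.ext ?_
  filter_upwards [coeFn_mulOp (memLp_top_matrix_mul hR hS) f, coeFn_mulOp hR (mulOp hS f),
    coeFn_mulOp hS f] with σ hprod hleft hright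
  rw [hprod, ContinuousLinearMap.comp_apply, hleft, hright, Matrix.toLpLin_mul_same,
    LinearMap.comp_apply]

end Product

variable [DecidableEq ι] {S : Ω → Matrix ι ι ℂ}

theorem coeFn_mulOp_pow (hS : MemLp S ⊤ μ) (f : Lp (EuclideanSpace ℂ ι) 2 μ) (k : ℕ) :
    (mulOp hS ^ k) f =ᵐ[μ] fun σ => Matrix.toEuclideanLin (S σ ^ k) (f σ) := by
  induction k with
  | zero => exact Eventually.of_forall fun σ => by simp
  | succ k ih =>
    rw [pow_succ']
    filter_upwards [coeFn_mulOp hS ((mulOp hS ^ k) f), ih] with σ hmul hpow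
    refine hmul.trans ?_
    rw [hpow, pow_succ', Matrix.toLpLin_mul_same, LinearMap.comp_apply]

theorem coeFn_sum_smul_mulOp_pow (hS : MemLp S ⊤ μ) (f : Lp (EuclideanSpace ℂ ι) 2 μ)
    (c : ℕ → ℂ) (s : Finset ℕ) :
    ⇑(∑ k ∈ s, (c k • mulOp hS ^ k) f) =ᵐ[μ]
      fun σ => matrixAction ι ι (∑ k ∈ s, c k • S σ ^ k) (f σ) := by
  filter_upwards [Lp.coeFn_finsetSum s fun k => (c k • mulOp hS ^ k) f,
    ae_all_iff.2 fun k => Lp.coeFn_smul (c k) ((mulOp hS ^ k) f),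
    ae_all_iff.2 (coeFn_mulOp_pow hS f)] with σ hsum hsmul hpow
  rw [hsum, Finset.sum_apply, map_sum, sum_apply]
  refine Finset.sum_congr rfl fun k _ => (hsmul k).trans ?_
  rw [Pi.smul_apply, hpow, map_smul]
  rfl

-- `L²` convergence of the exponential series gives pointwise convergence along a subsequence.
theorem coeFn_exp_mulOp (hS : MemLp S ⊤ μ) (f : Lp (EuclideanSpace ℂ ι) 2 μ) :
    NormedSpace.exp (mulOp hS) f =ᵐ[μ]
      fun σ => Matrix.toEuclideanLin (NormedSpace.exp (S σ)) (f σ) := by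
  have hconv : Tendsto
      (fun N => ∑ k ∈ Finset.range N, ((k.factorial : ℂ)⁻¹ • mulOp hS ^ k) f) atTop
      (𝓝 (NormedSpace.exp (mulOp hS) f)) :=
    ((NormedSpace.exp_series_hasSum_exp' (𝕂 := ℂ) (mulOp hS)).mapL
      (ContinuousLinearMap.apply ℂ _ f)).tendsto_sum_nat
  obtain ⟨N, hN, hae⟩ := (tendstoInMeasure_of_tendsto_Lp hconv).exists_seq_tendsto_ae
  filter_upwards [hae, ae_all_iff.2 fun N =>
    coeFn_sum_smul_mulOp_pow hS f (fun k => (k.factorial : ℂ)⁻¹) (Finset.range N)] with σ hlim hsum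
  have hcont : Continuous fun M : Matrix ι ι ℂ => matrixAction ι ι M (f σ) :=
    ((matrixAction ι ι).flip (f σ)).continuous
  have hexp := (hcont.tendsto _).comp
    (NormedSpace.exp_series_hasSum_exp' (𝕂 := ℂ) (S σ)).tendsto_sum_nat
  exact tendsto_nhds_unique (hlim.congr fun i => hsum (N i)) (hexp.comp hN.tendsto_atTop)

theorem norm_exp_smul_mulOp_le (hS : MemLp S ⊤ μ) (t : ℝ) {c : ℝ} (hc : 0 ≤ c)
    (h : ∀ᵐ σ ∂μ, ‖NormedSpace.exp (t • S σ)‖ ≤ c) :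
    ‖NormedSpace.exp (t • mulOp hS)‖ ≤ c := by
  have hsmul : t • mulOp hS = mulOp (hS.const_smul t) := by
    refine (Complex.coe_smul t (mulOp hS)).symm.trans ?_
    exact (map_smul ((matrixAction ι ι).holderL μ ⊤ 2 2) (t : ℂ) (hS.toLp S)).symm
  rw [hsmul]
  refine ContinuousLinearMap.opNorm_le_bound _ hc fun f => Lp.norm_le_mul_norm_of_ae_le_mul ?_
  filter_upwards [coeFn_exp_mulOp (hS.const_smul t) f, h] with σ hexp hle
  rw [hexp]
  exact (Matrix.l2_opNorm_mulVec _ _).trans (mul_le_mul_of_nonneg_right hle (norm_nonneg _))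

end Multiplication

/-! ### Passive systems -/

section PassiveSystem

variable {E H : Type*} [NormedAddCommGroup E] [InnerProductSpace ℂ E]
  [NormedAddCommGroup H] [InnerProductSpace ℂ H]

/-- The linear system `ẋ = a x + b u`, `y = c x + d u`, started at rest, is passive: the work
`∫₀ᵀ Re ⟪u, y⟫` done by every locally square integrable input is nonnegative. -/
def IsPassiveSystem (a : H →L[ℂ] H) (b : E →L[ℂ] H) (c : H →L[ℂ] E) (d : E →L[ℂ] E) : Prop :=
  ∀ (u : ℝ → E) (x : ℝ → H), (∀ T : ℝ, 0 < T → MemLp u 2 (volume.restrict (Ioc 0 T))) →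
    (∀ T : ℝ, 0 < T → SolvesStateEquation a (fun t => b (u t)) x T) →
    ∀ T : ℝ, 0 < T → 0 ≤ ∫ t in (0 : ℝ)..T, (inner ℂ (u t) (c (x t) + d (u t))).re

variable {a : H →L[ℂ] H} {b : E →L[ℂ] H} {c : H →L[ℂ] E} {d : E →L[ℂ] E}

theorem IsExpStable.isPassiveSystem_iff [CompleteSpace E] [CompleteSpace H] (ha : IsExpStable a) :
    IsPassiveSystem a b c d ↔ ∀ (ω : ℝ) (z : H) (w : E), (Complex.I * ω) • z - a z = b w →
      0 ≤ (inner ℂ w (c z + d w)).re := by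
  refine ⟨fun hpassive ω z w hzw =>
    ha.re_inner_nonneg_of_integral_nonneg (ω := ω) (hpassive _ _ ?_ ?_),
    fun hpos u x hu hx T hT => (hx T hT).integral_re_inner_nonneg ha hpos hT.le (hu T hT)⟩
  · intro T _
    have hphase (t : ℝ) : ‖Complex.exp (Complex.I * ω * t) • w‖ = ‖w‖ := by
      simp [norm_smul, Complex.norm_exp]
    exact MemLp.of_bound (Continuous.aestronglyMeasurable (by fun_prop)) ‖w‖
      (Eventually.of_forall fun t => (hphase t).le)
  · intro T _
    simpa only [map_smul, ← hzw] using solvesStateEquation_harmonic a ω z T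

theorem IsExpStable.exists_smul_sub_eq [CompleteSpace H] (ha : IsExpStable a) (ω : ℝ) (y : H) :
    ∃ z, (Complex.I * ω) • z - a z = y := by
  set J := ∫ t in Ioi (0 : ℝ), NormedSpace.exp (t • (a - (Complex.I * ω) • (1 : H →L[ℂ] H)))
  have hJ : (a - (Complex.I * ω) • (1 : H →L[ℂ] H)) (J y) = -y :=
    congrArg (fun L : H →L[ℂ] H => L y) (ha.sub_smul_one ω).mul_integral_exp
  refine ⟨J y, ?_⟩
  rw [← neg_sub, neg_eq_iff_eq_neg]
  exact hJ

variable {E' H' : Type*} [NormedAddCommGroup E'] [InnerProductSpace ℂ E']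
  [NormedAddCommGroup H'] [InnerProductSpace ℂ H']
  {a' : H' →L[ℂ] H'} {b' : E' →L[ℂ] H'} {c' : H' →L[ℂ] E'} {d' : E' →L[ℂ] E'}

theorem IsPassiveSystem.integral_nonneg_of_intertwines [CompleteSpace H] [CompleteSpace H']
    (h : IsPassiveSystem a' b' c' d') {V : E →L[ℂ] E'} {W : H →L[ℂ] H'}
    (ha : ∀ z, W (a z) = a' (W z)) (hb : ∀ w, W (b w) = b' (V w))
    (hc : ∀ z, V (c z) = c' (W z)) (hd : ∀ w, V (d w) = d' (V w)) {u : ℝ → E} {x : ℝ → H}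
    (hu : ∀ T : ℝ, 0 < T → MemLp u 2 (volume.restrict (Ioc 0 T)))
    (hx : ∀ T : ℝ, 0 < T → SolvesStateEquation a (fun t => b (u t)) x T) {T : ℝ} (hT : 0 < T) :
    0 ≤ ∫ t in (0 : ℝ)..T, (inner ℂ (V (u t)) (V (c (x t) + d (u t)))).re := by
  simpa only [map_add, hc, hd] using h (fun t => V (u t)) (fun t => W (x t))
    (fun T hT => V.comp_memLp' (hu T hT))
    (fun T hT => by simpa only [hb] using (hx T hT).map a.continuous ha) T hT

theorem IsPassiveSystem.of_isometry [CompleteSpace H] [CompleteSpace H']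
    (h : IsPassiveSystem a' b' c' d') (V : E →ₗᵢ[ℂ] E') (W : H →L[ℂ] H')
    (ha : ∀ z, W (a z) = a' (W z)) (hb : ∀ w, W (b w) = b' (V w))
    (hc : ∀ z, V (c z) = c' (W z)) (hd : ∀ w, V (d w) = d' (V w)) :
    IsPassiveSystem a b c d := fun _ _ hu hx _ hT => by
  simpa using h.integral_nonneg_of_intertwines (V := V.toContinuousLinearMap) ha hb hc hd hu hx hT

theorem memLp_output {u : ℝ → E} {x : ℝ → H} {T : ℝ}
    (hu : MemLp u 2 (volume.restrict (Ioc 0 T))) (hx : ContinuousOn x (Icc 0 T)) :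
    MemLp (fun t => c (x t) + d (u t)) 2 (volume.restrict (Ioc 0 T)) := by
  refine (c.comp_memLp' ?_).add (d.comp_memLp' hu)
  obtain ⟨C, hC⟩ := isCompact_Icc.exists_bound_of_continuousOn hx
  have hbound : ∀ᵐ t ∂volume.restrict (Ioc 0 T), ‖x t‖ ≤ C :=
    ae_restrict_of_forall_mem measurableSet_Ioc fun t ht => hC t (Ioc_subset_Icc_self ht)
  rw [restrict_Ioc_eq_restrict_Icc] at hbound ⊢
  exact .of_bound (hx.aestronglyMeasurable_of_isCompact isCompact_Icc measurableSet_Icc) C hbound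

-- Dominated convergence: the restricted supply rates are bounded by `‖u‖ ‖y‖`.
theorem isPassiveSystem_of_tendsto_inner [CompleteSpace H] {E' H' : ℕ → Type*}
    [∀ k, NormedAddCommGroup (E' k)] [∀ k, InnerProductSpace ℂ (E' k)]
    [∀ k, NormedAddCommGroup (H' k)] [∀ k, InnerProductSpace ℂ (H' k)] [∀ k, CompleteSpace (H' k)]
    {a' : ∀ k, H' k →L[ℂ] H' k} {b' : ∀ k, E' k →L[ℂ] H' k} {c' : ∀ k, H' k →L[ℂ] E' k}
    {d' : ∀ k, E' k →L[ℂ] E' k} (h : ∀ k, IsPassiveSystem (a' k) (b' k) (c' k) (d' k))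
    {V : ∀ k, E →L[ℂ] E' k} {W : ∀ k, H →L[ℂ] H' k}
    (ha : ∀ k z, W k (a z) = a' k (W k z)) (hb : ∀ k w, W k (b w) = b' k (V k w))
    (hc : ∀ k z, V k (c z) = c' k (W k z)) (hd : ∀ k w, V k (d w) = d' k (V k w))
    (hV : ∀ k w, ‖V k w‖ ≤ ‖w‖)
    (hlim : ∀ w y, Tendsto (fun k => inner ℂ (V k w) (V k y)) atTop (𝓝 (inner ℂ w y))) :
    IsPassiveSystem a b c d := by
  intro u x hu hx T hT
  set y : ℝ → E := fun t => c (x t) + d (u t)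
  have hy : MemLp y 2 (volume.restrict (Ioc 0 T)) := memLp_output (hu T hT) (hx T hT).continuousOn
  refine ge_of_tendsto' (x := atTop (α := ℕ)) ?_ fun k =>
    (h k).integral_nonneg_of_intertwines (ha k) (hb k) (hc k) (hd k) hu hx hT
  simp only [intervalIntegral.integral_of_le hT.le]
  refine tendsto_integral_of_dominated_convergence (fun t => ‖u t‖ * ‖y t‖) (fun k => ?_)
    ((hu T hT).norm.integrable_mul hy.norm) (fun k => Eventually.of_forall fun t => ?_)
    (Eventually.of_forall fun t => Complex.continuous_re.tendsto _ |>.comp (hlim _ _))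
  · exact Complex.continuous_re.comp_aestronglyMeasurable
      (((V k).comp_memLp' (hu T hT)).1.inner ((V k).comp_memLp' hy).1)
  · calc |(inner ℂ (V k (u t)) (V k (y t))).re| ≤ ‖V k (u t)‖ * ‖V k (y t)‖ :=
          (Complex.abs_re_le_norm _).trans (norm_inner_le_norm _ _)
      _ ≤ ‖u t‖ * ‖y t‖ := by gcongr <;> exact hV k _

end PassiveSystem

/-! ### The transfer matrix and its supply form -/

section SupplyForm

variable {κ : Type*} [Fintype κ] [DecidableEq κ] {n : ℕ}

/-- The transfer matrix `C (s - A)⁻¹ B + D` of a finite-dimensional system. -/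
def transferMatrix {ι : Type*} (A : Matrix (Fin n) (Fin n) ℂ) (B : Matrix (Fin n) κ ℂ)
    (C : Matrix ι (Fin n) ℂ) (D : Matrix ι κ ℂ) (s : ℂ) : Matrix ι κ ℂ :=
  C * (s • (1 : Matrix (Fin n) (Fin n) ℂ) - A)⁻¹ * B + D

/-- The power `Re ⟪v, F(iω) v⟫` supplied to a finite-dimensional system with transfer matrix `F`
by an input of amplitude `v` and frequency `ω`. -/
def supplyForm (A : Matrix (Fin n) (Fin n) ℂ) (B : Matrix (Fin n) κ ℂ) (C : Matrix κ (Fin n) ℂ)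
    (D : Matrix κ κ ℂ) (ω : ℝ) (v : EuclideanSpace ℂ κ) : ℝ :=
  (inner ℂ v (Matrix.toEuclideanLin (transferMatrix A B C D (Complex.I * ω)) v)).re

variable {A : Matrix (Fin n) (Fin n) ℂ} {B : Matrix (Fin n) κ ℂ}

theorem IsHurwitz.continuous_supplyForm (hA : IsHurwitz A) (B : Matrix (Fin n) κ ℂ)
    (C : Matrix κ (Fin n) ℂ) (D : Matrix κ κ ℂ) :
    Continuous fun p : ℝ × EuclideanSpace ℂ κ => supplyForm A B C D p.1 p.2 := by
  have hinv : Continuous fun ω : ℝ =>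
      ((Complex.I * ω) • (1 : Matrix (Fin n) (Fin n) ℂ) - A)⁻¹ := by
    have hres : Continuous fun ω : ℝ =>
      (Complex.I * ω) • (1 : Matrix (Fin n) (Fin n) ℂ) - A := by fun_prop
    simp_rw [Matrix.inv_def, Ring.inverse_eq_inv']
    exact (hres.matrix_det.inv₀ fun ω => (hA.isUnit_det_smul_one_sub ω).ne_zero).smul
      hres.matrix_adjugate
  have htransfer : Continuous fun p : ℝ × EuclideanSpace ℂ κ =>
      transferMatrix A B C D (Complex.I * p.1) := by
    exact ((continuous_const.matrix_mul (hinv.comp continuous_fst)).matrix_mul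
      continuous_const).add continuous_const
  exact Complex.continuous_re.comp (continuous_snd.inner
    (((matrixAction κ κ).continuous.comp htransfer).clm_apply continuous_snd))

theorem IsHurwitz.toEuclideanLin_transferMatrix_apply {ι : Type*} (hA : IsHurwitz A)
    {ω : ℝ} {z : EuclideanSpace ℂ (Fin n)} {v : EuclideanSpace ℂ κ}
    (hz : (Complex.I * ω) • z - Matrix.toEuclideanLin A z = Matrix.toEuclideanLin B v)
    (C : Matrix ι (Fin n) ℂ) (D : Matrix ι κ ℂ) :
    Matrix.toEuclideanLin (transferMatrix A B C D (Complex.I * ω)) v =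
      Matrix.toEuclideanLin C z + Matrix.toEuclideanLin D v := by
  set R := (Complex.I * ω) • (1 : Matrix (Fin n) (Fin n) ℂ) - A with hR
  have hRz : Matrix.toEuclideanLin R z = Matrix.toEuclideanLin B v := by
    rw [← hz, hR, map_sub, map_smul, LinearMap.sub_apply, LinearMap.smul_apply,
      Matrix.toLpLin_one, LinearMap.id_apply]
  have hinv : Matrix.toEuclideanLin R⁻¹ (Matrix.toEuclideanLin B v) = z := by
    rw [← hRz, ← LinearMap.comp_apply, ← Matrix.toLpLin_mul_same,
      Matrix.nonsing_inv_mul _ (hA.isUnit_det_smul_one_sub ω), Matrix.toLpLin_one,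
      LinearMap.id_apply]
  rw [transferMatrix, map_add, LinearMap.add_apply, Matrix.toLpLin_mul_same,
    LinearMap.comp_apply, Matrix.toLpLin_mul_same, LinearMap.comp_apply, hinv]

theorem IsHurwitz.supplyForm_nonneg_of_denseRange (hA : IsHurwitz A) {C : Matrix κ (Fin n) ℂ}
    {D : Matrix κ κ ℂ} {ι : Type*} {e : ι → ℝ × EuclideanSpace ℂ κ} (he : DenseRange e)
    (h : ∀ i, 0 ≤ supplyForm A B C D (e i).1 (e i).2) :
    ∀ p : ℝ × EuclideanSpace ℂ κ, 0 ≤ supplyForm A B C D p.1 p.2 :=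
  isClosed_property he (isClosed_le continuous_const (hA.continuous_supplyForm B C D)) h

end SupplyForm

/-! ### Passive multiplication systems -/

section MultiplicationSystem

variable {Ω : Type*} [MeasurableSpace Ω] {μ : Measure Ω} {κ : Type*} [Fintype κ] [DecidableEq κ]
  {n : ℕ} {A : Ω → Matrix (Fin n) (Fin n) ℂ} {B : Ω → Matrix (Fin n) κ ℂ}
  {C : Ω → Matrix κ (Fin n) ℂ} {D : Ω → Matrix κ κ ℂ}

theorem re_inner_ae_eq_supplyForm (hA : MemLp A ⊤ μ) (hB : MemLp B ⊤ μ) (hC : MemLp C ⊤ μ)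
    (hD : MemLp D ⊤ μ) (hHurwitz : ∀ᵐ σ ∂μ, IsHurwitz (A σ)) {ω : ℝ}
    {z : Lp (EuclideanSpace ℂ (Fin n)) 2 μ} {w : Lp (EuclideanSpace ℂ κ) 2 μ}
    (hz : (Complex.I * ω) • z - mulOp hA z = mulOp hB w) :
    (fun σ => (inner ℂ (w σ) ((mulOp hC z + mulOp hD w : Lp (EuclideanSpace ℂ κ) 2 μ) σ)).re)
      =ᵐ[μ] fun σ => supplyForm (A σ) (B σ) (C σ) (D σ) ω (w σ) := by
  filter_upwards [hHurwitz, Lp.coeFn_sub ((Complex.I * ω) • z) (mulOp hA z),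
    Lp.coeFn_smul (Complex.I * ω) z, coeFn_mulOp hA z, coeFn_mulOp hB w,
    Lp.coeFn_add (mulOp hC z) (mulOp hD w), coeFn_mulOp hC z, coeFn_mulOp hD w]
    with σ hσ hsub hsmul hAz hBw hadd hCz hDw
  have hzσ : (Complex.I * ω) • z σ - Matrix.toEuclideanLin (A σ) (z σ) =
      Matrix.toEuclideanLin (B σ) (w σ) := by
    rw [← hBw, ← hz, hsub, Pi.sub_apply, hsmul, hAz, Pi.smul_apply]
  rw [supplyForm, hσ.toEuclideanLin_transferMatrix_apply hzσ, hadd, Pi.add_apply, hCz, hDw]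

theorem re_inner_eq_integral_re {F : Type*} [NormedAddCommGroup F] [InnerProductSpace ℂ F]
    (f g : Lp F 2 μ) : (inner ℂ f g).re = ∫ σ, (inner ℂ (f σ) (g σ)).re ∂μ := by
  rw [L2.inner_def]
  exact (integral_re (L2.integrable_inner (𝕜 := ℂ) f g)).symm

theorem IsExpStable.ae_supplyForm_nonneg [IsFiniteMeasure μ] {hA : MemLp A ⊤ μ}
    (hstable : IsExpStable (mulOp hA)) {hB : MemLp B ⊤ μ} {hC : MemLp C ⊤ μ} {hD : MemLp D ⊤ μ}
    (hHurwitz : ∀ᵐ σ ∂μ, IsHurwitz (A σ))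
    (h : IsPassiveSystem (mulOp hA) (mulOp hB) (mulOp hC) (mulOp hD)) (ω : ℝ)
    (v : EuclideanSpace ℂ κ) : ∀ᵐ σ ∂μ, 0 ≤ supplyForm (A σ) (B σ) (C σ) (D σ) ω v := by
  have hform {s : Set Ω} (hs : MeasurableSet s) :
      IntegrableOn (fun σ => supplyForm (A σ) (B σ) (C σ) (D σ) ω v) s μ ∧
        0 ≤ ∫ σ in s, supplyForm (A σ) (B σ) (C σ) (D σ) ω v ∂μ := by
    set w := indicatorConstLp 2 hs (measure_ne_top μ s) v
    obtain ⟨z, hz⟩ := hstable.exists_smul_sub_eq ω (mulOp hB w)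
    have hae : (fun σ => (inner ℂ (w σ) ((mulOp hC z + mulOp hD w : Lp _ 2 μ) σ)).re)
        =ᵐ[μ] s.indicator fun σ => supplyForm (A σ) (B σ) (C σ) (D σ) ω v := by
      filter_upwards [re_inner_ae_eq_supplyForm hA hB hC hD hHurwitz hz,
        indicatorConstLp_coeFn (hs := hs) (hμs := measure_ne_top μ s) (c := v) (p := 2)]
        with σ hsupply hw
      rw [hsupply, hw]
      by_cases hσ : σ ∈ s <;> simp [hσ, supplyForm]
    rw [← integrable_indicator_iff hs, ← integral_indicator hs, ← integrable_congr hae,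
      ← integral_congr_ae hae, ← re_inner_eq_integral_re]
    exact ⟨(L2.integrable_inner (𝕜 := ℂ) _ _).re, hstable.isPassiveSystem_iff.1 h ω z w hz⟩
  exact ae_nonneg_of_forall_setIntegral_nonneg
    (by simpa using (hform MeasurableSet.univ).1) fun s hs _ => (hform hs).2

theorem IsExpStable.isPassiveSystem_mulOp_iff [IsFiniteMeasure μ] {hA : MemLp A ⊤ μ}
    (hstable : IsExpStable (mulOp hA)) {hB : MemLp B ⊤ μ} {hC : MemLp C ⊤ μ} {hD : MemLp D ⊤ μ}
    (hHurwitz : ∀ᵐ σ ∂μ, IsHurwitz (A σ)) :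
    IsPassiveSystem (mulOp hA) (mulOp hB) (mulOp hC) (mulOp hD) ↔
      ∀ᵐ σ ∂μ, ∀ ω v, 0 ≤ supplyForm (A σ) (B σ) (C σ) (D σ) ω v := by
  refine ⟨fun h => ?_, fun h => hstable.isPassiveSystem_iff.2 fun ω z w hz => ?_⟩
  · let p : ℕ → ℝ × EuclideanSpace ℂ κ := TopologicalSpace.denseSeq _
    filter_upwards [hHurwitz, ae_all_iff.2 fun i =>
      hstable.ae_supplyForm_nonneg hHurwitz h (p i).1 (p i).2] with σ hσ hp
    exact fun ω v =>
      hσ.supplyForm_nonneg_of_denseRange (TopologicalSpace.denseRange_denseSeq _) hp (ω, v)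
  · rw [re_inner_eq_integral_re]
    refine integral_nonneg_of_ae ?_
    filter_upwards [re_inner_ae_eq_supplyForm hA hB hC hD hHurwitz hz, h] with σ hsupply hσ
    exact hsupply.symm ▸ hσ ω (w σ)

end MultiplicationSystem

/-! ### Localization of multiplication systems -/

section Localization

variable {Ω : Type*} [MeasurableSpace Ω] {μ : Measure Ω} {s : Set Ω}

section Restriction

variable {F : Type*} [NormedAddCommGroup F] [InnerProductSpace ℂ F]

/-- Extension by zero of a square integrable function on `s` to the whole space. -/
def extendByZero (μ : Measure Ω) (hs : MeasurableSet s) :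
    Lp F 2 (μ.restrict s) →ₗᵢ[ℂ] Lp F 2 μ where
  toFun f := ((memLp_indicator_iff_restrict hs).2 (Lp.memLp f)).toLp _
  map_add' f g := by
    rw [← MemLp.toLp_add, MemLp.toLp_eq_toLp_iff, ← indicator_add']
    exact (ae_eq_restrict_iff_indicator_ae_eq hs).1 (Lp.coeFn_add f g)
  map_smul' c f := by
    rw [RingHom.id_apply, ← MemLp.toLp_const_smul, MemLp.toLp_eq_toLp_iff]
    exact ((ae_eq_restrict_iff_indicator_ae_eq hs).1 (Lp.coeFn_smul c f)).trans
      (EventuallyEq.of_eq (indicator_const_smul s c f))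
  norm_map' f := by
    change ‖((memLp_indicator_iff_restrict hs).2 (Lp.memLp f)).toLp _‖ = ‖f‖
    rw [Lp.norm_toLp, eLpNorm_indicator_eq_eLpNorm_restrict hs, Lp.norm_def]

theorem coeFn_extendByZero (hs : MeasurableSet s) (f : Lp F 2 (μ.restrict s)) :
    extendByZero μ hs f =ᵐ[μ] s.indicator f :=
  ((memLp_indicator_iff_restrict hs).2 (Lp.memLp f)).coeFn_toLp

theorem inner_restrict (f g : Lp F 2 μ) :
    inner ℂ (LpToLpRestrictCLM Ω F ℂ μ 2 s f) (LpToLpRestrictCLM Ω F ℂ μ 2 s g) =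
      ∫ σ in s, inner ℂ (f σ) (g σ) ∂μ := by
  rw [L2.inner_def]
  refine integral_congr_ae ?_
  filter_upwards [LpToLpRestrictCLM_coeFn ℂ s f, LpToLpRestrictCLM_coeFn ℂ s g] with σ hf hg
  rw [hf, hg]

variable {ι κ : Type*} [Fintype ι] [Fintype κ] [DecidableEq κ] {M : Ω → Matrix ι κ ℂ}

theorem mulOp_extendByZero (hM : MemLp M ⊤ μ) (hs : MeasurableSet s)
    (f : Lp (EuclideanSpace ℂ κ) 2 (μ.restrict s)) :
    mulOp hM (extendByZero μ hs f) = extendByZero μ hs (mulOp (hM.restrict s) f) := by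
  refine Lp.ext ?_
  filter_upwards [coeFn_mulOp hM (extendByZero μ hs f), coeFn_extendByZero hs f,
    coeFn_extendByZero hs (mulOp (hM.restrict s) f),
    (ae_restrict_iff' hs).1 (coeFn_mulOp (hM.restrict s) f)] with σ hmul hf hMf hrestrict
  rw [hmul, hf, hMf]
  by_cases hσ : σ ∈ s
  · simp only [indicator_of_mem hσ, hrestrict hσ]
  · simp only [indicator_of_notMem hσ, map_zero]

theorem restrict_mulOp (hM : MemLp M ⊤ μ) (s : Set Ω) (f : Lp (EuclideanSpace ℂ κ) 2 μ) :
    LpToLpRestrictCLM Ω _ ℂ μ 2 s (mulOp hM f) =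
      mulOp (hM.restrict s) (LpToLpRestrictCLM Ω _ ℂ μ 2 s f) := by
  refine Lp.ext ?_
  filter_upwards [coeFn_mulOp (hM.restrict s) (LpToLpRestrictCLM Ω _ ℂ μ 2 s f),
    LpToLpRestrictCLM_coeFn ℂ s f, LpToLpRestrictCLM_coeFn ℂ s (mulOp hM f),
    ae_restrict_of_ae (coeFn_mulOp hM f)] with σ hmul hf hMf hrestrict
  rw [hmul, hf, hMf, hrestrict]

end Restriction

variable {κ : Type*} [Fintype κ] [DecidableEq κ] {n : ℕ} {A : Ω → Matrix (Fin n) (Fin n) ℂ}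
  {B : Ω → Matrix (Fin n) κ ℂ} {C : Ω → Matrix κ (Fin n) ℂ} {D : Ω → Matrix κ κ ℂ}

theorem isPassiveSystem_mulOp_iff_of_aecover {φ : ℕ → Set Ω} (hφ : AECover μ atTop φ)
    (hA : MemLp A ⊤ μ) (hB : MemLp B ⊤ μ) (hC : MemLp C ⊤ μ) (hD : MemLp D ⊤ μ) :
    IsPassiveSystem (mulOp hA) (mulOp hB) (mulOp hC) (mulOp hD) ↔
      ∀ k, IsPassiveSystem (mulOp (hA.restrict (φ k))) (mulOp (hB.restrict (φ k)))
        (mulOp (hC.restrict (φ k))) (mulOp (hD.restrict (φ k))) := by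
  refine ⟨fun h k => ?_, fun h => ?_⟩
  · have hk := hφ.measurableSet k
    exact h.of_isometry (extendByZero μ hk) (extendByZero μ hk).toContinuousLinearMap
      (fun f => (mulOp_extendByZero hA hk f).symm) (fun f => (mulOp_extendByZero hB hk f).symm)
      (fun f => (mulOp_extendByZero hC hk f).symm) (fun f => (mulOp_extendByZero hD hk f).symm)
  · refine isPassiveSystem_of_tendsto_inner h (V := fun k => LpToLpRestrictCLM Ω _ ℂ μ 2 (φ k))
      (W := fun k => LpToLpRestrictCLM Ω _ ℂ μ 2 (φ k)) (fun k => restrict_mulOp hA (φ k))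
      (fun k => restrict_mulOp hB (φ k)) (fun k => restrict_mulOp hC (φ k))
      (fun k => restrict_mulOp hD (φ k)) (fun k f => norm_Lp_toLp_restrict_le (φ k) f)
      fun f g => ?_
    simp_rw [inner_restrict]
    rw [L2.inner_def]
    exact hφ.integral_tendsto_of_countably_generated (L2.integrable_inner (𝕜 := ℂ) f g)

/-- The set of points where `exp ((k + 1) A)` has norm at most `1 / 2`. On it, multiplication by `A`
is exponentially stable; if `A` is Hurwitz almost everywhere, these sets exhaust `Ω`. -/
def contractionSet (A : Ω → Matrix (Fin n) (Fin n) ℂ) (k : ℕ) : Set Ω :=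
  {σ | ‖NormedSpace.exp (((k + 1 : ℕ) : ℝ) • A σ)‖ ≤ 1 / 2}

theorem measurableSet_contractionSet (hA : StronglyMeasurable A) (k : ℕ) :
    MeasurableSet (contractionSet A k) := by
  let : NormedAlgebra ℚ (Matrix (Fin n) (Fin n) ℂ) := NormedAlgebra.restrictScalars ℚ ℂ _
  have hexp : StronglyMeasurable fun σ => NormedSpace.exp (((k + 1 : ℕ) : ℝ) • A σ) :=
    (NormedSpace.exp_continuous.comp (continuous_const_smul _)).comp_stronglyMeasurable hA
  exact measurableSet_le hexp.norm.measurable measurable_const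

theorem aecover_contractionSet (hA : StronglyMeasurable A) (hHurwitz : ∀ᵐ σ ∂μ, IsHurwitz (A σ)) :
    AECover μ atTop (contractionSet A) := by
  refine ⟨hHurwitz.mono fun σ hσ => ?_, measurableSet_contractionSet hA⟩
  have hlim := (tendsto_add_atTop_iff_nat 1).2 hσ.tendsto_exp_natCast_smul
  exact hlim.norm.eventually_le_const (by norm_num)

theorem isExpStable_mulOp_restrict_contractionSet (hA : StronglyMeasurable A) (hA' : MemLp A ⊤ μ)
    (k : ℕ) : IsExpStable (mulOp (hA'.restrict (contractionSet A k))) := by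
  refine isExpStable_of_norm_exp_lt_one (τ := ((k + 1 : ℕ) : ℝ)) (by positivity)
    (lt_of_le_of_lt (norm_exp_smul_mulOp_le _ _ (c := 1 / 2) (by norm_num) ?_) (by norm_num))
  exact ae_restrict_mem (measurableSet_contractionSet hA k)

theorem ae_iff_forall_ae_restrict_of_aecover {φ : ℕ → Set Ω} (hφ : AECover μ atTop φ)
    {p : Ω → Prop} : (∀ᵐ σ ∂μ, p σ) ↔ ∀ k, ∀ᵐ σ ∂μ.restrict (φ k), p σ := by
  refine ⟨fun h k => ae_restrict_of_ae h, fun h => ?_⟩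
  filter_upwards [hφ.ae_eventually_mem,
    ae_all_iff.2 fun k => (ae_restrict_iff' (hφ.measurableSet k)).1 (h k)] with σ hmem hp
  obtain ⟨k, hk⟩ := hmem.exists
  exact hp k hk

theorem isPassiveSystem_mulOp_iff [IsFiniteMeasure μ] (hA : StronglyMeasurable A)
    (hA' : MemLp A ⊤ μ) (hB : MemLp B ⊤ μ) (hC : MemLp C ⊤ μ) (hD : MemLp D ⊤ μ)
    (hHurwitz : ∀ᵐ σ ∂μ, IsHurwitz (A σ)) :
    IsPassiveSystem (mulOp hA') (mulOp hB) (mulOp hC) (mulOp hD) ↔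
      ∀ᵐ σ ∂μ, ∀ ω v, 0 ≤ supplyForm (A σ) (B σ) (C σ) (D σ) ω v := by
  have hcover := aecover_contractionSet hA hHurwitz
  rw [isPassiveSystem_mulOp_iff_of_aecover hcover,
    ae_iff_forall_ae_restrict_of_aecover hcover]
  exact forall_congr' fun k =>
    (isExpStable_mulOp_restrict_contractionSet hA hA' k).isPassiveSystem_mulOp_iff
      (ae_restrict_of_ae hHurwitz)

end Localization

/-! ### Fourier series on the torus -/

section Torus

variable {ν : ℕ}

theorem conj_character (ℓ : Lattice ν) (σ : Torus ν) :
    starRingEnd ℂ (character ℓ σ) = character (-ℓ) σ := by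
  simp only [character, ContinuousMap.coe_mk, map_prod, ← fourier_neg, Pi.neg_apply]

theorem character_add (k ℓ : Lattice ν) (σ : Torus ν) :
    character (k + ℓ) σ = character k σ * character ℓ σ := by
  simp only [character, ContinuousMap.coe_mk, Pi.add_apply, neg_add, fourier_add,
    Finset.prod_mul_distrib]

theorem character_mul_conj_character (k ℓ : Lattice ν) (σ : Torus ν) :
    character k σ * starRingEnd ℂ (character ℓ σ) = character (k - ℓ) σ := by
  rw [conj_character, ← character_add, sub_eq_add_neg]

theorem integral_fourier {L : ℝ} [hL : Fact (0 < L)] (k : ℤ) :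
    ∫ θ : AddCircle L, fourier k θ = if k = 0 then (L : ℂ) else 0 := by
  split_ifs with hk
  · simp [hk, Measure.real, AddCircle.measure_univ, hL.out.le]
  · exact integral_eq_zero_of_add_right_eq_neg (fourier_add_half_inv_index hk hL.out)

theorem integral_character (ℓ : Lattice ν) :
    ∫ σ : Torus ν, character ℓ σ = if ℓ = 0 then ((2 * Real.pi) ^ ν : ℂ) else 0 := by
  refine (integral_fintype_prod_volume_eq_prod (𝕜 := ℂ)
    fun (k : Fin ν) (θ : AddCircle (2 * Real.pi)) => (fourier (-ℓ k) θ : ℂ)).trans ?_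
  simp_rw [integral_fourier, neg_eq_zero]
  split_ifs with hℓ
  · simp [hℓ]
  · obtain ⟨i, hi⟩ := Function.ne_iff.1 hℓ
    exact Finset.prod_eq_zero (Finset.mem_univ i) (if_neg hi)

theorem fourier_homeomorphAddCircle {L : ℝ} (hL : L ≠ 0) (k : ℤ) (θ : AddCircle L) :
    fourier k (AddCircle.homeomorphAddCircle L 1 hL one_ne_zero θ) = fourier k θ := by
  induction θ using QuotientAddGroup.induction_on with
  | H x =>
    change fourier k ((x * (L⁻¹ * 1) : ℝ) : AddCircle (1 : ℝ)) = fourier k (x : AddCircle L)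
    rw [fourier_coe_apply, fourier_coe_apply]
    push_cast
    field_simp

theorem topologicalClosure_span_character :
    (Submodule.span ℂ (range (character (ν := ν)))).topologicalClosure = ⊤ := by
  let e : Torus ν ≃ₜ UnitAddTorus (Fin ν) := Homeomorph.piCongrRight fun _ =>
    AddCircle.homeomorphAddCircle (2 * Real.pi) 1 Real.two_pi_pos.ne' one_ne_zero
  let pullback := ContinuousMap.compCLM (M := ℂ) ℂ (e : C(Torus ν, UnitAddTorus (Fin ν)))
  have hsurj : Function.Surjective pullback := fun f =>
    ⟨f.comp (e.symm : C(UnitAddTorus (Fin ν), Torus ν)), by ext; simp [pullback]⟩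
  have hcharacter (ℓ : Lattice ν) : pullback (UnitAddTorus.mFourier (-ℓ)) = character ℓ := by
    ext σ
    change ∏ k, fourier (-ℓ k) (e σ k) = ∏ k, fourier (-ℓ k) (σ k)
    exact Finset.prod_congr rfl fun k _ =>
      fourier_homeomorphAddCircle Real.two_pi_pos.ne' (-ℓ k) (σ k)
  have hrange : range (character (ν := ν)) = pullback '' range UnitAddTorus.mFourier := by
    rw [← range_comp, ← neg_surjective.range_comp (pullback ∘ UnitAddTorus.mFourier)]
    exact congrArg range (funext fun ℓ => (hcharacter ℓ).symm)
  rw [hrange]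
  exact (Submodule.map_span pullback.toLinearMap _).symm ▸
    hsurj.denseRange.topologicalClosure_map_submodule UnitAddTorus.span_mFourier_closure_eq_top

/-- The character `exp (-i ℓᵀσ)` in `L²`. -/
abbrev characterLp (ℓ : Lattice ν) : Lp ℂ 2 (volume : Measure (Torus ν)) :=
  ContinuousMap.toLp 2 volume ℂ (character ℓ)

variable (ν) in
/-- The `L²` norm `(2π)^(ν/2)` of a character. -/
def characterNorm : ℝ := √((2 * Real.pi) ^ ν)

theorem characterNorm_ne_zero : (characterNorm ν : ℂ) ≠ 0 :=
  Complex.ofReal_ne_zero.2 (Real.sqrt_pos.2 (pow_pos Real.two_pi_pos ν)).ne'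

theorem characterNorm_mul_self :
    (characterNorm ν : ℂ) * characterNorm ν = (2 * Real.pi) ^ ν := by
  rw [← Complex.ofReal_mul, characterNorm, Real.mul_self_sqrt (pow_pos Real.two_pi_pos ν).le]
  push_cast
  rfl

theorem orthonormal_character :
    Orthonormal ℂ fun ℓ : Lattice ν => (characterNorm ν : ℂ)⁻¹ • characterLp ℓ := by
  rw [orthonormal_iff_ite]
  intro k ℓ
  rw [inner_smul_left, inner_smul_right, ContinuousMap.inner_toLp]
  simp_rw [character_mul_conj_character, integral_character, sub_eq_zero, map_inv₀,
    Complex.conj_ofReal, eq_comm (a := ℓ)]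
  split_ifs
  · rw [← characterNorm_mul_self]
    field_simp [characterNorm_ne_zero (ν := ν)]
  · simp

theorem topologicalClosure_span_characterLp :
    (Submodule.span ℂ (range fun ℓ : Lattice ν =>
      (characterNorm ν : ℂ)⁻¹ • characterLp ℓ)).topologicalClosure = ⊤ := by
  have hdense := (ContinuousMap.toLp_denseRange ℂ (volume : Measure (Torus ν)) ℂ
    (p := 2) ENNReal.ofNat_ne_top).topologicalClosure_map_submodule
      (topologicalClosure_span_character (ν := ν))
  refine top_unique (hdense.ge.trans (Submodule.topologicalClosure_mono ?_))
  rw [Submodule.map_span, Submodule.span_le]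
  rintro _ ⟨_, ⟨ℓ, rfl⟩, rfl⟩
  exact (Submodule.smul_mem_iff _ (inv_ne_zero characterNorm_ne_zero)).1
    (Submodule.subset_span ⟨ℓ, rfl⟩)

variable (ν) in
/-- The Hilbert basis of normalized characters of `L²(𝕋^ν)`. -/
def characterBasis : HilbertBasis (Lattice ν) ℂ (Lp ℂ 2 (volume : Measure (Torus ν))) :=
  HilbertBasis.mk orthonormal_character topologicalClosure_span_characterLp.ge

theorem characterBasis_apply (ℓ : Lattice ν) :
    characterBasis ν ℓ = (characterNorm ν : ℂ)⁻¹ • characterLp ℓ :=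
  congrFun (HilbertBasis.coe_mk _ _) ℓ

theorem coeFn_characterBasis (ℓ : Lattice ν) :
    characterBasis ν ℓ =ᵐ[volume] fun σ => (characterNorm ν : ℂ)⁻¹ * character ℓ σ := by
  rw [characterBasis_apply]
  filter_upwards [Lp.coeFn_smul (characterNorm ν : ℂ)⁻¹ (characterLp ℓ),
    ContinuousMap.coeFn_toLp (𝕜 := ℂ) (p := 2) volume (character ℓ)] with σ hsmul hcharacter
  rw [hsmul, Pi.smul_apply, hcharacter, smul_eq_mul]

/-- The Fourier series with square summable real coefficients. -/
def scalarSymbol (a : Lattice ν → ℝ) : Lp ℂ 2 (volume : Measure (Torus ν)) :=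
  ∑' ℓ, (a ℓ : ℂ) • characterLp ℓ

theorem repr_scalarSymbol {a : Lattice ν → ℝ} (ha : Summable fun ℓ => a ℓ ^ 2) (ℓ : Lattice ν) :
    (characterBasis ν).repr (scalarSymbol a) ℓ = characterNorm ν * a ℓ := by
  have hmem : Memℓp (fun ℓ => (characterNorm ν : ℂ) * a ℓ) 2 := by
    refine memℓp_gen ?_
    simpa [mul_pow] using ha.mul_left (characterNorm ν ^ 2)
  have hsymbol : scalarSymbol a = (characterBasis ν).repr.symm ⟨_, hmem⟩ := by
    rw [← ((characterBasis ν).hasSum_repr_symm ⟨_, hmem⟩).tsum_eq, scalarSymbol]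
    refine tsum_congr fun ℓ => ?_
    rw [characterBasis_apply, smul_smul]
    field_simp [characterNorm_ne_zero (ν := ν)]
  rw [hsymbol, LinearIsometryEquiv.apply_symm_apply]

theorem memLp_conj_mul_characterBasis (s : Lp ℂ 2 (volume : Measure (Torus ν))) (ℓ : Lattice ν) :
    MemLp (fun σ => starRingEnd ℂ (s σ) * characterBasis ν ℓ σ) 2 volume := by
  have hbounded : MemLp (fun σ => (characterNorm ν : ℂ)⁻¹ * character ℓ σ) ⊤ volume :=
    (continuous_const.mul (character ℓ).continuous).memLp_top_of_hasCompactSupport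
      (HasCompactSupport.of_compactSpace _) volume
  exact (hbounded.ae_eq (coeFn_characterBasis ℓ).symm).mul (Lp.memLp s).star

-- Both sides are Parseval's identity for `⟪conj s · χ_j, f⟫`, as `χ_j · conj χ_k = χ_{j-k}`.
theorem hasSum_repr_mul {s f h : Lp ℂ 2 (volume : Measure (Torus ν))}
    (hfh : h =ᵐ[volume] fun σ => s σ * f σ) (j : Lattice ν) :
    HasSum (fun k => (characterNorm ν : ℂ)⁻¹ * (characterBasis ν).repr s (j - k) *
      (characterBasis ν).repr f k) ((characterBasis ν).repr h j) := by
  have hmem := memLp_conj_mul_characterBasis s j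
  have hproduct : inner ℂ (hmem.toLp _) f = (characterBasis ν).repr h j := by
    rw [HilbertBasis.repr_apply_apply, L2.inner_def, L2.inner_def]
    refine integral_congr_ae ?_
    filter_upwards [hmem.coeFn_toLp, hfh] with σ htoLp hσ
    rw [htoLp, hσ]
    simp only [RCLike.inner_apply, map_mul, Complex.conj_conj]
    ring
  have hcoefficient (k : Lattice ν) : inner ℂ (hmem.toLp _) (characterBasis ν k) =
      (characterNorm ν : ℂ)⁻¹ * (characterBasis ν).repr s (j - k) := by
    rw [HilbertBasis.repr_apply_apply, L2.inner_def, L2.inner_def, ← integral_const_mul]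
    refine integral_congr_ae ?_
    filter_upwards [hmem.coeFn_toLp, coeFn_characterBasis j, coeFn_characterBasis k,
      coeFn_characterBasis (j - k)] with σ htoLp hj hk hjk
    rw [htoLp, hj, hk, hjk, ← character_mul_conj_character]
    simp only [RCLike.inner_apply, map_mul, Complex.conj_conj, map_inv₀, Complex.conj_ofReal]
    ring
  rw [← hproduct]
  refine ((characterBasis ν).hasSum_inner_mul_inner (hmem.toLp _) f).congr_fun fun k => ?_
  rw [hcoefficient, (characterBasis ν).repr_apply_apply f]

end Torus

/-! ### Fourier coefficients of vector-valued functions -/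

section VectorFourier

variable {ν p : ℕ}

/-- The Hilbert space `L²(𝕋^ν, ℂ^p)`. -/
abbrev TorusL2 (ν p : ℕ) : Type :=
  Lp (EuclideanSpace ℂ (Fin p)) 2 (volume : Measure (Torus ν))

/-- The `i`-th component of a square integrable vector-valued function on the torus. -/
def component (i : Fin p) : TorusL2 ν p →L[ℂ] Lp ℂ 2 (volume : Measure (Torus ν)) :=
  (EuclideanSpace.proj i : EuclideanSpace ℂ (Fin p) →L[ℂ] ℂ).compLpL 2 volume

theorem coeFn_component (i : Fin p) (f : TorusL2 ν p) :
    component i f =ᵐ[volume] fun σ => f σ i :=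
  (EuclideanSpace.proj i : EuclideanSpace ℂ (Fin p) →L[ℂ] ℂ).coeFn_compLpL f

theorem inner_eq_sum_inner_component (f g : TorusL2 ν p) :
    inner ℂ f g = ∑ i, inner ℂ (component i f) (component i g) := by
  simp_rw [L2.inner_def]
  rw [← integral_finsetSum _ fun i _ => L2.integrable_inner _ _]
  refine integral_congr_ae ?_
  filter_upwards [ae_all_iff.2 fun i => coeFn_component i f,
    ae_all_iff.2 fun i => coeFn_component i g] with σ hf hg
  simp only [PiLp.inner_apply, hf, hg]

/-- The `i`-th entry of the Fourier coefficient at `ℓ`, for the normalized characters. -/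
def fourierCoef (ℓ : Lattice ν) (i : Fin p) : TorusL2 ν p →L[ℂ] ℂ :=
  (innerSL ℂ (characterBasis ν ℓ)).comp (component i)

theorem fourierCoef_apply (ℓ : Lattice ν) (i : Fin p) (f : TorusL2 ν p) :
    fourierCoef ℓ i f = (characterBasis ν).repr (component i f) ℓ :=
  ((characterBasis ν).repr_apply_apply _ _).symm

theorem hasSum_inner_fourierCoef (f g : TorusL2 ν p) :
    HasSum (fun ℓ => ∑ i, starRingEnd ℂ (fourierCoef ℓ i f) * fourierCoef ℓ i g)
      (inner ℂ f g) := by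
  rw [inner_eq_sum_inner_component]
  refine hasSum_sum fun i _ => ?_
  refine ((characterBasis ν).hasSum_inner_mul_inner _ _).congr_fun fun ℓ => ?_
  simp only [fourierCoef_apply, HilbertBasis.repr_apply_apply, inner_conj_symm]

theorem hasSum_norm_sq_fourierCoef (f : TorusL2 ν p) :
    HasSum (fun ℓ => ∑ i, ‖fourierCoef ℓ i f‖ ^ 2) (‖f‖ ^ 2) := by
  have hsum := Complex.hasSum_re (hasSum_inner_fourierCoef f f)
  rw [← RCLike.re_eq_complex_re, inner_self_eq_norm_sq] at hsum
  refine hsum.congr_fun fun ℓ => ?_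
  simp only [RCLike.re_eq_complex_re, Complex.re_sum, Complex.conj_mul', ← Complex.ofReal_pow,
    Complex.ofReal_re]

theorem norm_sq_re_fourierCoef_le (f : TorusL2 ν p) (ℓ : Lattice ν) :
    ‖(WithLp.toLp 2 fun i => (fourierCoef ℓ i f).re : EuclideanSpace ℝ (Fin p))‖ ^ 2 ≤
      ∑ i, ‖fourierCoef ℓ i f‖ ^ 2 := by
  rw [EuclideanSpace.norm_sq_eq]
  gcongr with i
  exact Complex.abs_re_le_norm _

theorem memℓp_re_fourierCoef (f : TorusL2 ν p) :
    Memℓp (E := fun _ : Lattice ν => EuclideanSpace ℝ (Fin p))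
      (fun ℓ => WithLp.toLp 2 fun i => (fourierCoef ℓ i f).re) 2 := by
  refine memℓp_gen ((hasSum_norm_sq_fourierCoef f).summable.of_nonneg_of_le
    (fun _ => by positivity) fun ℓ => ?_)
  simpa only [ENNReal.toReal_ofNat, Real.rpow_ofNat] using norm_sq_re_fourierCoef_le f ℓ

/-- The real parts of the Fourier coefficients, a square summable function on the lattice. -/
def reCoef : TorusL2 ν p →L[ℝ] SqSum ν p :=
  LinearMap.mkContinuous
    { toFun f := ⟨_, memℓp_re_fourierCoef f⟩
      map_add' f g := by
        ext ℓ i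
        change (fourierCoef ℓ i (f + g)).re = (fourierCoef ℓ i f).re + (fourierCoef ℓ i g).re
        rw [map_add, Complex.add_re]
      map_smul' c f := by
        ext ℓ i
        simp } 1 fun f => by
    rw [one_mul]
    refine le_of_sq_le_sq ?_ (norm_nonneg _)
    exact hasSum_le (norm_sq_re_fourierCoef_le f)
      (by simpa using lp.hasSum_norm (by simp) (⟨_, memℓp_re_fourierCoef f⟩ : SqSum ν p))
      (hasSum_norm_sq_fourierCoef f)

/-- The imaginary parts of the Fourier coefficients. -/
def imCoef : TorusL2 ν p →L[ℝ] SqSum ν p :=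
  reCoef.comp (-Complex.I • ContinuousLinearMap.id ℝ (TorusL2 ν p))

theorem reCoef_apply (f : TorusL2 ν p) (ℓ : Lattice ν) (i : Fin p) :
    reCoef f ℓ i = (fourierCoef ℓ i f).re :=
  rfl

theorem imCoef_eq (f : TorusL2 ν p) : imCoef f = reCoef (-Complex.I • f) :=
  rfl

theorem imCoef_apply (f : TorusL2 ν p) (ℓ : Lattice ν) (i : Fin p) :
    imCoef f ℓ i = (fourierCoef ℓ i f).im := by
  rw [imCoef_eq, reCoef_apply, map_smul]
  simp

theorem re_inner_eq (f g : TorusL2 ν p) :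
    (inner ℂ f g).re = inner ℝ (reCoef f) (reCoef g) + inner ℝ (imCoef f) (imCoef g) := by
  refine (Complex.hasSum_re (hasSum_inner_fourierCoef f g)).unique
    (((lp.hasSum_inner (reCoef f) (reCoef g)).add
      (lp.hasSum_inner (imCoef f) (imCoef g))).congr_fun fun ℓ => ?_)
  simp only [PiLp.inner_apply, ← Finset.sum_add_distrib, Complex.re_sum, reCoef_apply,
    imCoef_apply]
  refine Finset.sum_congr rfl fun i _ => ?_
  simp
  ring

theorem norm_sq_eq_reCoef_add_imCoef (f : TorusL2 ν p) :
    ‖f‖ ^ 2 = ‖reCoef f‖ ^ 2 + ‖imCoef f‖ ^ 2 := by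
  rw [← real_inner_self_eq_norm_sq (reCoef f), ← real_inner_self_eq_norm_sq (imCoef f),
    ← re_inner_eq, ← RCLike.re_eq_complex_re, inner_self_eq_norm_sq]

theorem eq_of_reCoef_eq_of_imCoef_eq {f g : TorusL2 ν p} (hre : reCoef f = reCoef g)
    (him : imCoef f = imCoef g) : f = g := by
  rw [← sub_eq_zero, ← norm_eq_zero, ← sq_eq_zero_iff, norm_sq_eq_reCoef_add_imCoef]
  simp [hre, him]

theorem exists_fourierCoef_eq (x : SqSum ν p) :
    ∃ f : TorusL2 ν p, ∀ ℓ i, fourierCoef ℓ i f = (x ℓ i : ℂ) := by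
  have hmem (i : Fin p) : Memℓp (fun ℓ : Lattice ν => (x ℓ i : ℂ)) 2 := by
    refine memℓp_gen (((lp.memℓp x).summable (by simp)).of_nonneg_of_le
      (fun _ => by positivity) fun ℓ => ?_)
    rw [Complex.norm_real]
    gcongr
    exact PiLp.norm_apply_le _ i
  let g (i : Fin p) : Lp ℂ 2 (volume : Measure (Torus ν)) :=
    (characterBasis ν).repr.symm ⟨_, hmem i⟩
  have hg : MemLp (fun σ => (WithLp.toLp 2 fun i => g i σ : EuclideanSpace ℂ (Fin p))) 2
      (volume : Measure (Torus ν)) := MemLp.of_eval_piLp fun i => Lp.memLp (g i)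
  refine ⟨hg.toLp _, fun ℓ i => ?_⟩
  have hcomponent : component i (hg.toLp _) = g i := by
    refine Lp.ext ?_
    filter_upwards [coeFn_component i (hg.toLp _), hg.coeFn_toLp] with σ hσ htoLp
    rw [hσ, htoLp]
  rw [fourierCoef_apply, hcomponent, LinearIsometryEquiv.apply_symm_apply]

theorem exists_reCoef_eq_imCoef_eq_zero (x : SqSum ν p) :
    ∃ f : TorusL2 ν p, reCoef f = x ∧ imCoef f = 0 := by
  obtain ⟨f, hf⟩ := exists_fourierCoef_eq x
  refine ⟨f, ?_, ?_⟩ <;> ext ℓ i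
  · rw [reCoef_apply, hf, Complex.ofReal_re]
  · rw [imCoef_apply, hf, Complex.ofReal_im]
    rfl

/-- The normalized Fourier series of a square summable real function on the lattice. -/
def fourierSeries : SqSum ν p →ₗᵢ[ℝ] TorusL2 ν p where
  toFun x := (exists_reCoef_eq_imCoef_eq_zero x).choose
  map_add' x y := by
    apply eq_of_reCoef_eq_of_imCoef_eq <;>
      simp [(exists_reCoef_eq_imCoef_eq_zero _).choose_spec]
  map_smul' c x := by
    apply eq_of_reCoef_eq_of_imCoef_eq <;>
      simp [(exists_reCoef_eq_imCoef_eq_zero _).choose_spec]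
  norm_map' x := by
    obtain ⟨hre, him⟩ := (exists_reCoef_eq_imCoef_eq_zero x).choose_spec
    refine (sq_eq_sq₀ (norm_nonneg _) (norm_nonneg _)).1
      ((norm_sq_eq_reCoef_add_imCoef (exists_reCoef_eq_imCoef_eq_zero x).choose).trans ?_)
    simp [hre, him]

@[simp]
theorem reCoef_fourierSeries (x : SqSum ν p) : reCoef (fourierSeries x) = x :=
  (exists_reCoef_eq_imCoef_eq_zero x).choose_spec.1

@[simp]
theorem imCoef_fourierSeries (x : SqSum ν p) : imCoef (fourierSeries x) = 0 :=
  (exists_reCoef_eq_imCoef_eq_zero x).choose_spec.2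

end VectorFourier

/-! ### Multipliers -/

theorem norm_matrix_apply_le {m n 𝕜 : Type*} [Fintype m] [Fintype n] [DecidableEq n] [RCLike 𝕜]
    (M : Matrix m n 𝕜) (i : m) (j : n) : ‖M i j‖ ≤ ‖M‖ := by
  have hcolumn := Matrix.l2_opNorm_mulVec M (EuclideanSpace.single j 1)
  simpa using (PiLp.norm_apply_le (WithLp.toLp 2 (M.mulVec (Pi.single j 1))) i).trans hcolumn

theorem summable_sq_apply_of_summable_norm_sq {α m n : Type*} [Fintype m] [Fintype n]
    [DecidableEq n] {M : α → Matrix m n ℝ} (hM : Summable fun a => ‖M a‖ ^ 2) (i : m) (j : n) :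
    Summable fun a => M a i j ^ 2 := by
  refine Summable.of_nonneg_of_le (fun _ => sq_nonneg _) (fun a => ?_) hM
  rw [← sq_abs, ← Real.norm_eq_abs]
  gcongr
  exact norm_matrix_apply_le _ i j

section Multiplier

variable {ν p q : ℕ} {M : Lattice ν → Matrix (Fin p) (Fin q) ℝ}

theorem symbol_apply (M : Lattice ν → Matrix (Fin p) (Fin q) ℝ) (σ : Torus ν) (i : Fin p)
    (j : Fin q) : symbol M σ i j = scalarSymbol (fun ℓ => M ℓ i j) σ :=
  rfl

theorem stronglyMeasurable_symbol (M : Lattice ν → Matrix (Fin p) (Fin q) ℝ) :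
    StronglyMeasurable (symbol M) := by
  have hsum : symbol M = fun σ => ∑ i, ∑ j,
      scalarSymbol (fun ℓ => M ℓ i j) σ • Matrix.single i j (1 : ℂ) := by
    funext σ
    refine (Matrix.matrix_eq_sum_single _).trans ?_
    simp only [symbol_apply, Matrix.smul_single, smul_eq_mul, mul_one]
  rw [hsum]
  exact Finset.stronglyMeasurable_fun_sum _ fun i _ => Finset.stronglyMeasurable_fun_sum _
    fun j _ => (Lp.stronglyMeasurable _).smul_const _

/-- The matrices for which the Toeplitz operator is bounded on `ℓ²`: square summable, so that the
symbol is defined, with an essentially bounded symbol. -/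
structure IsMultiplier (M : Lattice ν → Matrix (Fin p) (Fin q) ℝ) : Prop where
  summable_sq : ∀ i j, Summable fun ℓ => M ℓ i j ^ 2
  bounded : BoundedSymbol M

namespace IsMultiplier

theorem memLp (hM : IsMultiplier M) : MemLp (symbol M) ⊤ (volume : Measure (Torus ν)) := by
  refine ⟨(stronglyMeasurable_symbol M).aestronglyMeasurable, ?_⟩
  rw [eLpNorm_exponent_top]
  exact hM.bounded

theorem memLp_scalarSymbol_mul (hM : IsMultiplier M) (f : TorusL2 ν q) (i : Fin p) (j : Fin q) :
    MemLp (fun σ => scalarSymbol (fun ℓ => M ℓ i j) σ * component j f σ) 2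
      (volume : Measure (Torus ν)) := by
  have hentry : MemLp (scalarSymbol fun ℓ => M ℓ i j) ⊤ (volume : Measure (Torus ν)) :=
    hM.memLp.of_le (Lp.aestronglyMeasurable _)
      (ae_of_all _ fun σ => norm_matrix_apply_le (symbol M σ) i j)
  exact (Lp.memLp (component j f)).mul' hentry

theorem hasSum_fourierCoef_mulOp (hM : IsMultiplier M) (f : TorusL2 ν q) (j : Lattice ν)
    (i : Fin p) :
    HasSum (fun k => ∑ l, (M (j - k) i l : ℂ) * fourierCoef k l f)
      (fourierCoef j i (mulOp hM.memLp f)) := by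
  have hmem := hM.memLp_scalarSymbol_mul f i
  have hcomponent : component i (mulOp hM.memLp f) = ∑ l, (hmem l).toLp _ := by
    refine Lp.ext ?_
    filter_upwards [coeFn_component i (mulOp hM.memLp f), coeFn_mulOp hM.memLp f,
      ae_all_iff.2 fun l => coeFn_component l f, ae_all_iff.2 fun l => (hmem l).coeFn_toLp,
      Lp.coeFn_finsetSum Finset.univ fun l => (hmem l).toLp _]
      with σ hcomp hmul hf hterm hsum
    rw [hcomp, hmul, hsum, Finset.sum_apply]
    simp only [hterm, hf]
    simp [symbol_apply, Matrix.toLpLin_apply, Matrix.mulVec, dotProduct]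
  rw [fourierCoef_apply, hcomponent, map_sum, lp.coeFn_sum, Finset.sum_apply]
  refine (hasSum_sum fun l _ => hasSum_repr_mul (hmem l).coeFn_toLp j).congr_fun
    fun k => Finset.sum_congr rfl fun l _ => ?_
  rw [repr_scalarSymbol (hM.summable_sq i l), fourierCoef_apply,
    inv_mul_cancel_left₀ characterNorm_ne_zero]

theorem toeplitz_reCoef (hM : IsMultiplier M) (f : TorusL2 ν q) (j : Lattice ν) :
    toeplitz M (reCoef f) j = reCoef (mulOp hM.memLp f) j := by
  have hcoord : HasSum (fun k (i : Fin p) => ∑ l, M (j - k) i l * (fourierCoef k l f).re)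
      (fun i => (fourierCoef j i (mulOp hM.memLp f)).re) := by
    refine Pi.hasSum.2 fun i => ?_
    refine (Complex.hasSum_re (hM.hasSum_fourierCoef_mulOp f j i)).congr_fun fun k => ?_
    simp only [Complex.re_sum, Complex.re_ofReal_mul]
  refine ((hcoord.map (WithLp.linearEquiv 2 ℝ (Fin p → ℝ)).symm
    (PiLp.continuous_toLp 2 _)).congr_fun fun k => ?_).tsum_eq
  ext i
  simp [Matrix.toLpLin_apply, Matrix.mulVec, dotProduct, reCoef_apply]

/-- The block Toeplitz operator on `ℓ²`, conjugate to multiplication by the symbol. -/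
def toeplitzOp (hM : IsMultiplier M) : SqSum ν q →L[ℝ] SqSum ν p :=
  reCoef.comp (((mulOp hM.memLp).restrictScalars ℝ).comp fourierSeries.toContinuousLinearMap)

theorem toeplitzOp_apply (hM : IsMultiplier M) (x : SqSum ν q) (j : Lattice ν) :
    hM.toeplitzOp x j = toeplitz M x j := by
  conv_rhs => rw [← reCoef_fourierSeries x, hM.toeplitz_reCoef]
  rfl

theorem toeplitzOp_reCoef (hM : IsMultiplier M) (f : TorusL2 ν q) :
    hM.toeplitzOp (reCoef f) = reCoef (mulOp hM.memLp f) :=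
  lp.ext (funext fun j => (hM.toeplitzOp_apply _ j).trans (hM.toeplitz_reCoef f j))

theorem toeplitzOp_imCoef (hM : IsMultiplier M) (f : TorusL2 ν q) :
    hM.toeplitzOp (imCoef f) = imCoef (mulOp hM.memLp f) := by
  rw [imCoef_eq, toeplitzOp_reCoef, map_smul, imCoef_eq]

theorem fourierSeries_toeplitzOp (hM : IsMultiplier M) (x : SqSum ν q) :
    fourierSeries (hM.toeplitzOp x) = mulOp hM.memLp (fourierSeries x) := by
  apply eq_of_reCoef_eq_of_imCoef_eq
  · rw [reCoef_fourierSeries, ← hM.toeplitzOp_reCoef, reCoef_fourierSeries]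
  · rw [imCoef_fourierSeries, ← hM.toeplitzOp_imCoef, imCoef_fourierSeries, map_zero]

end IsMultiplier

end Multiplier

/-! ### The network as a system on `L²(𝕋^ν)` -/

section Network

variable {ν n m r : ℕ}
  {A : Lattice ν → Matrix (Fin n) (Fin n) ℝ} {B : Lattice ν → Matrix (Fin n) (Fin m) ℝ}
  {C : Lattice ν → Matrix (Fin r) (Fin n) ℝ} {D : Lattice ν → Matrix (Fin r) (Fin m) ℝ}
  {G : Lattice ν → Matrix (Fin m) (Fin r) ℝ}

theorem intervalIntegral_sqSum_apply {p : ℕ} {g : ℝ → SqSum ν p} {t₁ t₂ : ℝ}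
    (hg : IntervalIntegrable g volume t₁ t₂) (j : Lattice ν) :
    (∫ t in t₁..t₂, g t) j = ∫ t in t₁..t₂, g t j :=
  ((lp.evalCLM ℝ (fun _ : Lattice ν => EuclideanSpace ℝ (Fin p)) 2 j).intervalIntegral_comp_comm
    hg).symm

theorem IsMultiplier.supplyRate_eq_inner (hG : IsMultiplier G) (u : SqSum ν m) (y : SqSum ν r) :
    supplyRate G u y = inner ℝ u (hG.toeplitzOp y) := by
  simp only [supplyRate, lp.inner_eq_tsum, hG.toeplitzOp_apply]

theorem isTrajectory_and_eq_zero_iff (hA : IsMultiplier A) (hB : IsMultiplier B)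
    (hC : IsMultiplier C) (hD : IsMultiplier D) {u : ℝ → SqSum ν m}
    (hu : ∀ T : ℝ, 0 < T → MemLp u 2 (volume.restrict (Ioc 0 T))) {x : ℝ → SqSum ν n}
    {y : ℝ → SqSum ν r} :
    IsTrajectory A B C D u x y ∧ x 0 = 0 ↔
      (∀ T : ℝ, 0 < T → SolvesStateEquation hA.toeplitzOp (fun t => hB.toeplitzOp (u t)) x T) ∧
        ∀ t : ℝ, 0 ≤ t → y t = hC.toeplitzOp (x t) + hD.toeplitzOp (u t) := by
  have hBu (T : ℝ) (hT : 0 < T) : IntegrableOn (fun t => hB.toeplitzOp (u t)) (Ioc 0 T) :=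
    hB.toeplitzOp.integrable_comp ((hu T hT).integrable one_le_two)
  have hint {T : ℝ} (hT : 0 < T) (hx : ContinuousOn x (Icc 0 T)) {t : ℝ} (ht : t ∈ Icc 0 T) :=
    intervalIntegrable_stateEquation hA.toeplitzOp.continuous hx (hBu T hT) ht
  constructor
  · rintro ⟨h, hzero⟩
    refine ⟨fun T hT => ?_, fun t ht => lp.ext (funext fun j => ?_)⟩
    · have hx : ContinuousOn x (Icc 0 T) := h.continuousOn_state.mono Icc_subset_Ici_self
      refine ⟨hx, hBu T hT, fun t ht => lp.ext (funext fun j => ?_)⟩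
      rw [h.state_eq t ht.1 j, hzero, intervalIntegral_sqSum_apply (hint hT hx ht)]
      simp [hA.toeplitzOp_apply, hB.toeplitzOp_apply]
    · rw [h.output_eq t ht j]
      simp [hC.toeplitzOp_apply, hD.toeplitzOp_apply]
  · rintro ⟨hx, hy⟩
    have hzero : x 0 = 0 := by
      simpa using (hx 1 one_pos).eq_integral 0 (left_mem_Icc.2 zero_le_one)
    have hmem {t : ℝ} (ht : 0 ≤ t) : t ∈ Icc 0 (t + 1) := ⟨ht, (lt_add_one t).le⟩
    refine ⟨⟨fun t ht => ?_, fun t ht j => ?_, fun t ht j => ?_⟩, hzero⟩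
    · have hxt := (hx (t + 1) (ht.trans_lt (lt_add_one t))).continuousOn t (hmem ht)
      refine hxt.mono_of_mem_nhdsWithin ?_
      rw [← Ici_inter_Iic]
      exact inter_mem_nhdsWithin _ (Iic_mem_nhds (lt_add_one t))
    · have hxt := hx (t + 1) (by positivity)
      rw [hzero, hxt.eq_integral t (hmem ht),
        intervalIntegral_sqSum_apply (hint (by positivity) hxt.continuousOn (hmem ht))]
      simp [hA.toeplitzOp_apply, hB.toeplitzOp_apply]
    · rw [hy t ht]
      simp [hC.toeplitzOp_apply, hD.toeplitzOp_apply]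

theorem isPassive_iff_forall_solvesStateEquation (hA : IsMultiplier A) (hB : IsMultiplier B)
    (hC : IsMultiplier C) (hD : IsMultiplier D) (hG : IsMultiplier G) :
    IsPassive A B C D G ↔ ∀ (u : ℝ → SqSum ν m) (x : ℝ → SqSum ν n),
      (∀ T : ℝ, 0 < T → MemLp u 2 (volume.restrict (Ioc 0 T))) →
      (∀ T : ℝ, 0 < T →
        SolvesStateEquation hA.toeplitzOp (fun t => hB.toeplitzOp (u t)) x T) →
      ∀ T : ℝ, 0 < T → 0 ≤ ∫ t in (0 : ℝ)..T,
        inner ℝ (u t) (hG.toeplitzOp (hC.toeplitzOp (x t) + hD.toeplitzOp (u t))) := by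
  have hsupply {u : ℝ → SqSum ν m} {x : ℝ → SqSum ν n} {y : ℝ → SqSum ν r}
      (hy : ∀ t : ℝ, 0 ≤ t → y t = hC.toeplitzOp (x t) + hD.toeplitzOp (u t)) {T : ℝ}
      (hT : 0 < T) : ∫ t in (0 : ℝ)..T, supplyRate G (u t) (y t) = ∫ t in (0 : ℝ)..T,
        inner ℝ (u t) (hG.toeplitzOp (hC.toeplitzOp (x t) + hD.toeplitzOp (u t))) := by
    refine intervalIntegral.integral_congr fun t ht => ?_
    rw [uIcc_of_le hT.le] at ht
    simp only [hG.supplyRate_eq_inner, hy t ht.1]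
  constructor
  · intro h u x hu hx T hT
    have hu' : LocallySquareIntegrable u := fun T hT => by
      simpa only [restrict_Ioc_eq_restrict_Icc] using hu T hT
    obtain ⟨htraj, hzero⟩ :=
      (isTrajectory_and_eq_zero_iff hA hB hC hD hu).2 ⟨hx, fun _ _ => rfl⟩
    exact (h u hu' x _ htraj hzero T hT).trans_eq (hsupply (fun _ _ => rfl) hT)
  · intro h u hu x y htraj hzero T hT
    have hu' (T : ℝ) (hT : 0 < T) : MemLp u 2 (volume.restrict (Ioc 0 T)) := by
      simpa only [restrict_Ioc_eq_restrict_Icc] using hu T hT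
    obtain ⟨hx, hy⟩ := (isTrajectory_and_eq_zero_iff hA hB hC hD hu').1 ⟨htraj, hzero⟩
    exact (h u x hu' hx T hT).trans_eq (hsupply hy hT).symm

theorem isPassive_iff_isPassiveSystem_comp (hA : IsMultiplier A) (hB : IsMultiplier B)
    (hC : IsMultiplier C) (hD : IsMultiplier D) (hG : IsMultiplier G) :
    IsPassive A B C D G ↔ IsPassiveSystem (mulOp hA.memLp) (mulOp hB.memLp)
      (mulOp hG.memLp ∘L mulOp hC.memLp) (mulOp hG.memLp ∘L mulOp hD.memLp) := by
  rw [isPassive_iff_forall_solvesStateEquation hA hB hC hD hG]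
  constructor
  · intro h u x hu hx T hT
    have hre := h (fun t => reCoef (u t)) (fun t => reCoef (x t))
      (fun T hT => reCoef.comp_memLp' (hu T hT)) (fun T hT => by
      simpa only [hB.toeplitzOp_reCoef] using
        (hx T hT).map (mulOp hA.memLp).continuous fun z => (hA.toeplitzOp_reCoef z).symm) T hT
    have him := h (fun t => imCoef (u t)) (fun t => imCoef (x t))
      (fun T hT => imCoef.comp_memLp' (hu T hT)) (fun T hT => by
      simpa only [hB.toeplitzOp_imCoef] using
        (hx T hT).map (mulOp hA.memLp).continuous fun z => (hA.toeplitzOp_imCoef z).symm) T hT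
    have hy := memLp_output (c := mulOp hG.memLp ∘L mulOp hC.memLp)
      (d := mulOp hG.memLp ∘L mulOp hD.memLp) (hu T hT) (hx T hT).continuousOn
    simp only [map_add, hC.toeplitzOp_reCoef, hD.toeplitzOp_reCoef, hG.toeplitzOp_reCoef] at hre
    simp only [map_add, hC.toeplitzOp_imCoef, hD.toeplitzOp_imCoef, hG.toeplitzOp_imCoef] at him
    simp_rw [re_inner_eq]
    rw [intervalIntegral.integral_add]
    · simpa only [ContinuousLinearMap.comp_apply, map_add] using add_nonneg hre him
    all_goals rw [intervalIntegrable_iff_integrableOn_Ioc_of_le hT.le]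
    · exact integrable_inner_of_memLp_two (reCoef.comp_memLp' (hu T hT)) (reCoef.comp_memLp' hy)
    · exact integrable_inner_of_memLp_two (imCoef.comp_memLp' (hu T hT)) (imCoef.comp_memLp' hy)
  · intro h u x hu hx T hT
    have hpos := h (fun t => fourierSeries (u t)) (fun t => fourierSeries (x t))
      (fun T hT => fourierSeries.toContinuousLinearMap.comp_memLp' (hu T hT)) (fun T hT => by
        simp only [← hB.fourierSeries_toeplitzOp]
        exact (hx T hT).map hA.toeplitzOp.continuous
          (W := fourierSeries.toContinuousLinearMap) hA.fourierSeries_toeplitzOp) T hT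
    simpa only [re_inner_eq, ContinuousLinearMap.comp_apply, ← hC.fourierSeries_toeplitzOp,
      ← hD.fourierSeries_toeplitzOp, ← hG.fourierSeries_toeplitzOp, reCoef_fourierSeries,
      imCoef_fourierSeries, inner_zero_left, add_zero, ← map_add] using hpos

end Network

/-! ### Positivity of the transfer function -/

theorem posSemidef_conjTranspose_add_self_iff {κ : Type*} [Fintype κ] [DecidableEq κ]
    {Z : Matrix κ κ ℂ} :
    (Z.conjTranspose + Z).PosSemidef ↔
      ∀ v, 0 ≤ (inner ℂ v (Matrix.toEuclideanLin Z v)).re := by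
  have hform (v : EuclideanSpace ℂ κ) : star v.ofLp ⬝ᵥ (Z.conjTranspose + Z).mulVec v.ofLp =
      ((2 * (inner ℂ v (Matrix.toEuclideanLin Z v)).re : ℝ) : ℂ) := by
    have hinner : inner ℂ v (Matrix.toEuclideanLin Z v) = star v.ofLp ⬝ᵥ Z.mulVec v.ofLp := by
      rw [EuclideanSpace.inner_eq_star_dotProduct, dotProduct_comm]
      rfl
    have hconj : star v.ofLp ⬝ᵥ Z.conjTranspose.mulVec v.ofLp =
        starRingEnd ℂ (star v.ofLp ⬝ᵥ Z.mulVec v.ofLp) := by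
      rw [starRingEnd_apply, ← Matrix.star_dotProduct, Matrix.star_mulVec,
        ← Matrix.dotProduct_mulVec]
    rw [Matrix.add_mulVec, dotProduct_add, hconj, hinner, add_comm, Complex.add_conj]
  have hhermitian : (Z.conjTranspose + Z).IsHermitian := by
    rw [Matrix.IsHermitian, Matrix.conjTranspose_add, Matrix.conjTranspose_conjTranspose, add_comm]
  rw [Matrix.posSemidef_iff_dotProduct_mulVec, and_iff_right hhermitian,
    (WithLp.equiv 2 (κ → ℂ)).symm.forall_congr_left]
  refine forall_congr' fun v => ?_
  refine Iff.trans (by rfl) ((iff_of_eq (congrArg (0 ≤ ·) (hform v))).trans ?_)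
  rw [Complex.zero_le_real, mul_nonneg_iff_of_pos_left two_pos]

theorem IsHurwitz.supplyForm_nonneg_of_ae {κ : Type*} [Fintype κ] [DecidableEq κ] {n : ℕ}
    {A : Matrix (Fin n) (Fin n) ℂ} {B : Matrix (Fin n) κ ℂ} {C : Matrix κ (Fin n) ℂ}
    {D : Matrix κ κ ℂ} (hA : IsHurwitz A) (h : ∀ᵐ ω : ℝ, ∀ v, 0 ≤ supplyForm A B C D ω v)
    (ω : ℝ) (v : EuclideanSpace ℂ κ) : 0 ≤ supplyForm A B C D ω v := by
  have hcont : Continuous fun ω : ℝ => supplyForm A B C D ω v :=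
    (hA.continuous_supplyForm B C D).comp (f := fun ω : ℝ => (ω, v)) (by fun_prop)
  have hdense : Dense {ω : ℝ | 0 ≤ supplyForm A B C D ω v} :=
    Measure.dense_of_ae (h.mono fun ω hω => hω v)
  exact (isClosed_le continuous_const hcont).closure_subset_iff.2 subset_rfl (hdense ω)

theorem ae_prod_supplyForm_nonneg_iff {Ω κ : Type*} [MeasurableSpace Ω] {μ : Measure Ω}
    [SFinite μ] [Fintype κ] [DecidableEq κ] {n : ℕ} {A : Ω → Matrix (Fin n) (Fin n) ℂ}
    {B : Ω → Matrix (Fin n) κ ℂ} {C : Ω → Matrix κ (Fin n) ℂ} {D : Ω → Matrix κ κ ℂ}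
    (hA : ∀ᵐ σ ∂μ, IsHurwitz (A σ)) :
    (∀ᵐ p ∂(volume : Measure ℝ).prod μ,
      ∀ v, 0 ≤ supplyForm (A p.2) (B p.2) (C p.2) (D p.2) p.1 v) ↔
      ∀ᵐ σ ∂μ, ∀ ω v, 0 ≤ supplyForm (A σ) (B σ) (C σ) (D σ) ω v := by
  constructor
  · intro h
    have hswap := Measure.measurePreserving_swap.quasiMeasurePreserving.ae h
    filter_upwards [Measure.ae_ae_of_ae_prod hswap, hA] with σ hσ hHurwitz
    exact hHurwitz.supplyForm_nonneg_of_ae hσ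
  · intro h
    exact (Measure.quasiMeasurePreserving_snd.ae h).mono fun p hp => hp p.1

section Network

variable {ν n m r : ℕ}
  {A : Lattice ν → Matrix (Fin n) (Fin n) ℝ} {B : Lattice ν → Matrix (Fin n) (Fin m) ℝ}
  {C : Lattice ν → Matrix (Fin r) (Fin n) ℝ} {D : Lattice ν → Matrix (Fin r) (Fin m) ℝ}
  {G : Lattice ν → Matrix (Fin m) (Fin r) ℝ}

theorem posSemidef_transferFunction_iff (ω : ℝ) (σ : Torus ν) :
    ((transferFunction A B C D (Complex.I * ω) σ).conjTranspose * (symbol G σ).conjTranspose +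
        symbol G σ * transferFunction A B C D (Complex.I * ω) σ).PosSemidef ↔
      ∀ v, 0 ≤ supplyForm (symbol A σ) (symbol B σ) (symbol G σ * symbol C σ)
        (symbol G σ * symbol D σ) ω v := by
  rw [← Matrix.conjTranspose_mul, posSemidef_conjTranspose_add_self_iff]
  simp only [supplyForm, transferMatrix, transferFunction, Matrix.mul_add, Matrix.mul_assoc]

theorem isPassive_iff_isPassiveSystem (hA : IsMultiplier A) (hB : IsMultiplier B)
    (hC : IsMultiplier C) (hD : IsMultiplier D) (hG : IsMultiplier G) :
    IsPassive A B C D G ↔ IsPassiveSystem (mulOp hA.memLp) (mulOp hB.memLp)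
      (mulOp (memLp_top_matrix_mul hG.memLp hC.memLp))
      (mulOp (memLp_top_matrix_mul hG.memLp hD.memLp)) := by
  rw [isPassive_iff_isPassiveSystem_comp hA hB hC hD hG, mulOp_mul, mulOp_mul]

end Network

end LatticeNetwork

end

theorem theorem2 {ν n m r : ℕ}
    (A : Lattice ν → Matrix (Fin n) (Fin n) ℝ) (B : Lattice ν → Matrix (Fin n) (Fin m) ℝ)
    (C : Lattice ν → Matrix (Fin r) (Fin n) ℝ) (D : Lattice ν → Matrix (Fin r) (Fin m) ℝ)
    (G : Lattice ν → Matrix (Fin m) (Fin r) ℝ)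
    (hABCD : Summable fun ℓ => ‖Matrix.fromBlocks (A ℓ) (B ℓ) (C ℓ) (D ℓ)‖ ^ 2)
    (hA : BoundedSymbol A) (hB : BoundedSymbol B) (hC : BoundedSymbol C) (hD : BoundedSymbol D)
    (hGsum : Summable fun ℓ => ‖G ℓ‖ ^ 2) (hG : BoundedSymbol G)
    (hHurwitz : ∀ᵐ σ : Torus ν, IsHurwitz (symbol A σ)) :
    IsPassive A B C D G ↔
      ∀ᵐ p : ℝ × Torus ν,
        ((transferFunction A B C D (Complex.I * p.1) p.2).conjTranspose *
            (symbol G p.2).conjTranspose +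
          symbol G p.2 * transferFunction A B C D (Complex.I * p.1) p.2).PosSemidef := by
  have hentry := summable_sq_apply_of_summable_norm_sq hABCD
  have hA' : IsMultiplier A := ⟨fun i j => hentry (.inl i) (.inl j), hA⟩
  have hB' : IsMultiplier B := ⟨fun i j => hentry (.inl i) (.inr j), hB⟩
  have hC' : IsMultiplier C := ⟨fun i j => hentry (.inr i) (.inl j), hC⟩
  have hD' : IsMultiplier D := ⟨fun i j => hentry (.inr i) (.inr j), hD⟩
  have hG' : IsMultiplier G := ⟨summable_sq_apply_of_summable_norm_sq hGsum, hG⟩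
  rw [isPassive_iff_isPassiveSystem hA' hB' hC' hD' hG',
    isPassiveSystem_mulOp_iff (stronglyMeasurable_symbol A) hA'.memLp hB'.memLp _ _ hHurwitz,
    ← ae_prod_supplyForm_nonneg_iff hHurwitz]
  simp only [posSemidef_transferFunction_iff]
  rfl
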